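/- **Conventions.** A permutation $\pi$ of size $n$ is written $\pi(1),\dots,\pi(n)$; $\pi$ contains $\sigma$ if some subsequence of $\pi$ has the same relative order as $\sigma$; $\mathrm{Av}(F)$ is the class of permutations containing no member of $F$. The elements of $\pi$ are the points $(i,\pi(i))$ (left/right refers to $i$, below/above to $\pi(i)$). The graph $G_\pi$ has vertex set $\{1,\dots,n\}$, and distinct $\pi(i),\pi(j)$ are adjacent iff $|i-j|=1$ or $|\pi(i)-\pi(j)|=1$. The reverse-complement of $\pi$ is $n+1-\pi(n),\dots,n+1-\pi(1)$. For even $r\ge 2$, the elementary wall of height $r$ is obtained from the $(r+1)\times(2r+2)$ grid (vertices $(i,j)$ with $1\le i\le r+1$, $1\le j\le 2r+2$; two vertices adjacent iff $|i-i'|+|j-j'|=1$) by removing the vertices $(1,2r+2)$ and $(r+1,1)$, the edges $\{(i,2j),(i+1,2j)\}$ with $i$ odd and the edges $\{(i,2j-1),(i+1,2j-1)\}$ with $i$ even, $1\le j\le r+1$. An $r$-wall is a subdivision of it; a graph contains an $r$-wall if it has one as a subgraph. The $k$-track $\tau_k$ is the permutation of size $k^2$ order-isomorphic to $1,2k,3,2k+2,5,2k+4,\dots,k^2-1,k^2+2k-2$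 if $k$ is even, and to $1,2k,3,2k+2,\dots,k^2-k-1,k^2+k-2,k^2-k+1,k^2-k+3,\dots,k^2+k-1$ if $k$ is odd. Its elements are partitioned into increasing blocks $A_1,\dots,A_k$ of size $k$: for $2j\le k$, the $j$th group of $2k$ consecutive positions is occupied alternately by elements of $A_{2j-1}$ and of $A_{2j}$, beginning with $A_{2j-1}$; for odd $k$ the last $k$ positions are occupied by $A_k$. The $k$-spiral is the twirl of $\tau_k$ with respect to $A_1,\dots,A_k$, i.e. the permutation with blocks $A_1^*,\dots,A_k^*$ (the element $x\in A_i$ corresponding to $x^*\in A_i^*$) determined as follows. 1. The order inside $A_i$ is, for $i\equiv 1,2,3,0 \pmod 4$ respectively: reversed vertically only; kept; reversed horizontally only; reversed both horizontally and vertically. 2. For $x\in A_i$, $y\in A_{i+1}$: if $i\equiv0\pmod 4$, $x^*$ is above $y^*$ iff $x$ is below $y$; if $i\equiv1$, $x^*$ is to the right of $y^*$ iff $x$ is to the right of $y$; if $i\equiv2$, $x^*$ is above $y^*$ iff $x$ is above $y$; if $i\equiv3$, $x^*$ is to the right of $y^*$ iff $x$ is to the left of $y$. 3. For $i\ge 2$: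 if $i\equiv0\pmod 4$, $A_i^*$ is above $A_{i-1}^*$ and all $A^*_j$ with $j>i$ are above and to the left of $A^*_{i-1}$; if $i\equiv1$, $A_i^*$ is to the left of $A_{i-1}^*$ and all $A_j^*$, $j>i$, are below and to the left of $A_{i-1}^*$; if $i\equiv2$, $A_i^*$ is below $A_{i-1}^*$ and all $A_j^*$, $j>i$, are below and to the right of $A_{i-1}^*$; if $i\equiv3$, $A_i^*$ is to the right of $A_{i-1}^*$ and all $A_j^*$, $j>i$, are above and to the right of $A_{i-1}^*$. **Theorem.** Let $\pi\in\mathrm{Av}(2143,3412,3142)$, let $k\ge 0$ be an integer and let $r\ge 2$ be an even integer with $r\ge 300k^{3/2}$. If $G_\pi$ contains an $r$-wall, then $\pi$ contains the $k$-spiral or the reverse-complement of the $k$-spiral. -/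

import Mathlib

namespace PermPattern

/-! ### Permutations, containment, classes

A permutation of size `n` is an `Equiv.Perm (Fin n)` (positions and values are counted from `0`).
The element at position `i` has value `π i`. -/

/-- `Contains τ π`: the permutation `τ` contains `π` as a pattern. -/
def Contains {n k : ℕ} (τ : Equiv.Perm (Fin n)) (π : Equiv.Perm (Fin k)) : Prop :=
  ∃ f : Fin k → Fin n, StrictMono f ∧ ∀ a b : Fin k, τ (f a) < τ (f b) ↔ π a < π b

/-- The permutations of size `n` in the class `Av(F)`. -/
def Av (F : Set (Σ m : ℕ, Equiv.Perm (Fin m))) (n : ℕ) : Set (Equiv.Perm (Fin n)) :=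
  {π | ∀ σ ∈ F, ¬ Contains π σ.2}

/-- The permutation `2143`. -/
def p2143 : Equiv.Perm (Fin 4) := ⟨![1, 0, 3, 2], ![1, 0, 3, 2], by decide, by decide⟩

/-- The permutation `3412`. -/
def p3412 : Equiv.Perm (Fin 4) := ⟨![2, 3, 0, 1], ![2, 3, 0, 1], by decide, by decide⟩

/-- The permutation `3142`. -/
def p3142 : Equiv.Perm (Fin 4) := ⟨![2, 0, 3, 1], ![1, 3, 0, 2], by decide, by decide⟩

/-- The reverse-complement (rotation of the diagram by 180 degrees). -/
def revComp {n : ℕ} (π : Equiv.Perm (Fin n)) : Equiv.Perm (Fin n) :=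
  (Fin.revPerm.trans π).trans Fin.revPerm

/-- The permutation whose diagram is order-isomorphic to the set of points `(x e, y e)`,
`e : Fin n` (for injective `x` and `y`): `Tuple.sort x` sends a position to the point at this
position, and the inverse of `Tuple.sort y` sends a point to its vertical rank. -/
def ofPoints {n : ℕ} {α : Type*} [LinearOrder α] (x y : Fin n → α) : Equiv.Perm (Fin n) :=
  (Tuple.sort x).trans (Tuple.sort y).symm

/-- The reduction of a sequence of distinct numbers: the `i`th smallest is replaced by `i`. -/
def reduction {n : ℕ} {α : Type*} [LinearOrder α] (ω : Fin n → α) : Equiv.Perm (Fin n) :=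
  (Tuple.sort ω).symm

/-! ### The graph of a permutation -/

/-- The graph `G_π`. Its vertices are the values of `π`; two values are adjacent if they are
consecutive (red edge) or if their positions are consecutive (blue edge). -/
def permGraph {n : ℕ} (π : Equiv.Perm (Fin n)) : SimpleGraph (Fin n) where
  Adj a b := Nat.dist (π.symm a) (π.symm b) = 1 ∨ Nat.dist (a : ℕ) (b : ℕ) = 1
  symm := ⟨fun a b h => by simpa only [Nat.dist_comm] using h⟩
  loopless := ⟨fun a h => by simp [Nat.dist_self] at h⟩

/-! ### Walls -/

/-- The vertices of the elementary wall of height `r`: those of the `(r+1) × (2r+2)` grid without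
the two opposite corners `(1, 2r+2)` and `(r+1, 1)`. -/
def WallVertex (r : ℕ) : Type :=
  {p : ℕ × ℕ // (1 ≤ p.1 ∧ p.1 ≤ r + 1) ∧ (1 ≤ p.2 ∧ p.2 ≤ 2 * r + 2) ∧
    p ≠ (1, 2 * r + 2) ∧ p ≠ (r + 1, 1)}

/-- The grid edges `{(i, j), (i+1, j)}` that are deleted: `i` odd and `j` even, or `i` even and
`j` odd. -/
def WallRemoved (p q : ℕ × ℕ) : Prop :=
  q.1 = p.1 + 1 ∧ q.2 = p.2 ∧ ((Odd p.1 ∧ Even p.2) ∨ (Even p.1 ∧ Odd p.2))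

/-- The elementary wall of height `r` (used for even `r ≥ 2`). -/
def elementaryWall (r : ℕ) : SimpleGraph (WallVertex r) where
  Adj p q := Nat.dist p.1.1 q.1.1 + Nat.dist p.1.2 q.1.2 = 1 ∧
    ¬ WallRemoved p.1 q.1 ∧ ¬ WallRemoved q.1 p.1
  symm := ⟨fun p q h => ⟨by simpa only [Nat.dist_comm] using h.1, h.2.2, h.2.1⟩⟩
  loopless := ⟨fun p h => by simp [Nat.dist_self] at h⟩

/-- `G` contains a subdivision of `H` as a subgraph: the vertices of `H` are sent to distinct
branch vertices of `G`, and the edges of `H` to paths of `G` between the corresponding branch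
vertices; a path meets no branch vertices other than its two ends, and two paths meet only in
common ends. -/
def ContainsSubdivision {V W : Type*} (G : SimpleGraph V) (H : SimpleGraph W) : Prop :=
  ∃ (φ : W → V) (P : ∀ u v : W, H.Adj u v → G.Walk (φ u) (φ v)),
    Function.Injective φ ∧
    (∀ u v (h : H.Adj u v), (P u v h).IsPath) ∧
    (∀ u v (h : H.Adj u v), P v u h.symm = (P u v h).reverse) ∧
    (∀ u v (h : H.Adj u v) w, φ w ∈ (P u v h).support → w = u ∨ w = v) ∧
    (∀ u v (h : H.Adj u v) u' v' (h' : H.Adj u' v'), s(u, v) ≠ s(u', v') →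
      ∀ x, x ∈ (P u v h).support → x ∈ (P u' v' h').support →
        ∃ w, x = φ w ∧ (w = u ∨ w = v) ∧ (w = u' ∨ w = v'))

/-- `G` contains an `r`-wall, that is, a subdivision of the elementary wall of height `r`. -/
def ContainsWall {V : Type*} (G : SimpleGraph V) (r : ℕ) : Prop :=
  ContainsSubdivision G (elementaryWall r)

/-! ### Decompositions and the twirl

A partition of the elements of `π` into blocks `B_1, …, B_m` is given by a map `β` that sends
each position `i` to the index (from `1` to `m`) of the block of the element at position `i`. -/

/-- Stair-decompositions. -/
structure IsStairDecomp {n : ℕ} (π : Equiv.Perm (Fin n)) (m : ℕ) (β : Fin n → ℕ) : Prop where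
  range : ∀ i, 1 ≤ β i ∧ β i ≤ m
  increasing : ∀ i j, β i = β j → i < j → π i < π j
  above : ∀ i j, Odd (β i) → β j = β i + 1 → π i < π j
  right : ∀ i j, Even (β i) → β j = β i + 1 → i < j
  above_right : ∀ i j, β j = β i + 2 → i < j ∧ π i < π j

/-- Spiral decompositions. -/
structure IsSpiralDecomp {n : ℕ} (π : Equiv.Perm (Fin n)) (m : ℕ) (β : Fin n → ℕ) : Prop where
  range : ∀ i, 1 ≤ β i ∧ β i ≤ m
  odd_decreasing : ∀ i j, β i = β j → Odd (β i) → i < j → π j < π i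
  even_increasing : ∀ i j, β i = β j → Even (β i) → i < j → π i < π j
  next_above : ∀ i j, β j = β i + 1 → β j % 4 = 0 → π i < π j
  rest_above_left : ∀ i j, β i + 1 < β j → (β i + 1) % 4 = 0 → π i < π j ∧ j < i
  next_left : ∀ i j, β j = β i + 1 → β j % 4 = 1 → j < i
  rest_below_left : ∀ i j, β i + 1 < β j → (β i + 1) % 4 = 1 → π j < π i ∧ j < i
  next_below : ∀ i j, β j = β i + 1 → β j % 4 = 2 → π j < π i
  rest_below_right : ∀ i j, β i + 1 < β j → (β i + 1) % 4 = 2 → π j < π i ∧ i < j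
  next_right : ∀ i j, β j = β i + 1 → β j % 4 = 3 → i < j
  rest_above_right : ∀ i j, β i + 1 < β j → (β i + 1) % 4 = 3 → π i < π j ∧ i < j

/-- `π'` with the decomposition `β'` is the twirl of `π` with respect to the decomposition `β`
into `m` blocks; `e` sends the position of an element `x` of `π` to the position of the
corresponding element `x*` of `π'`. The center of the spiral lies to the right of and below the
blocks `B_i` with `i % 4 = 1`, to the right of and above those with `i % 4 = 2`, to the left of
and above those with `i % 4 = 3`, to the left of and below those with `i % 4 = 0`. The top-right
corner of each block has to be turned towards the center by flips of rows and columns. -/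
structure IsTwirl {n : ℕ} (π : Equiv.Perm (Fin n)) (m : ℕ) (β : Fin n → ℕ)
    (π' : Equiv.Perm (Fin n)) (β' : Fin n → ℕ) (e : Equiv.Perm (Fin n)) : Prop where
  spiral : IsSpiralDecomp π' m β'
  block : ∀ i, β' (e i) = β i
  block_one : ∀ i j, β i = β j → β i % 4 = 1 →
    (e i < e j ↔ i < j) ∧ (π' (e i) < π' (e j) ↔ π j < π i)
  block_two : ∀ i j, β i = β j → β i % 4 = 2 →
    (e i < e j ↔ i < j) ∧ (π' (e i) < π' (e j) ↔ π i < π j)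
  block_three : ∀ i j, β i = β j → β i % 4 = 3 →
    (e i < e j ↔ j < i) ∧ (π' (e i) < π' (e j) ↔ π i < π j)
  block_zero : ∀ i j, β i = β j → β i % 4 = 0 →
    (e i < e j ↔ j < i) ∧ (π' (e i) < π' (e j) ↔ π j < π i)
  next_zero : ∀ i j, β j = β i + 1 → β i % 4 = 0 → (π' (e j) < π' (e i) ↔ π i < π j)
  next_one : ∀ i j, β j = β i + 1 → β i % 4 = 1 → (e j < e i ↔ j < i)
  next_two : ∀ i j, β j = β i + 1 → β i % 4 = 2 → (π' (e j) < π' (e i) ↔ π j < π i)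
  next_three : ∀ i j, β j = β i + 1 → β i % 4 = 3 → (e j < e i ↔ i < j)

/-- Horizontal coordinate in the twirl of the element at position `i`. The blocks `B_{2p-1}` and
`B_{2p}` share columns; this group of columns is kept for odd `p`, and put to the left of the
center (first component `0`), and reversed for even `p`, and put to the right of the center (first
component `1`). -/
def twirlX {n : ℕ} (β : Fin n → ℕ) (i : Fin n) : ℕ ×ₗ ℤ :=
  let p := (β i + 1) / 2
  let x : ℤ := ((i : ℕ) : ℤ) + (n : ℤ) * (p : ℤ)
  if Odd p then toLex (0, x) else toLex (1, -x)

/-- Vertical coordinate in the twirl of the element at position `i`. The blocks `B_{2q}` and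
`B_{2q+1}` share rows; this group of rows is kept for odd `q`, and put below the center (first
component `0`), and reversed for even `q`, and put above the center (first component `1`). -/
def twirlY {n : ℕ} (π : Equiv.Perm (Fin n)) (β : Fin n → ℕ) (i : Fin n) : ℕ ×ₗ ℤ :=
  let q := β i / 2
  let y : ℤ := ((π i : ℕ) : ℤ) + (n : ℤ) * (q : ℤ)
  if Odd q then toLex (0, y) else toLex (1, -y)

/-- The twirl of `π` with respect to the decomposition `β`. -/
def twirl {n : ℕ} (π : Equiv.Perm (Fin n)) (β : Fin n → ℕ) : Equiv.Perm (Fin n) :=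
  ofPoints (twirlX β) (twirlY π β)

/-! ### Tracks and spirals -/

/-- The sequence whose reduction is the `k`-track:
`1, 2k, 3, 2k+2, 5, 2k+4, …, k²-1, k²+2k-2` for even `k`, and
`1, 2k, 3, 2k+2, 5, 2k+4, …, k²-k-1, k²+k-2, k²-k+1, k²-k+3, …, k²+k-1` for odd `k`. -/
def trackSeq (k : ℕ) (t : Fin (k ^ 2)) : ℕ :=
  if Odd k ∧ k * (k - 1) ≤ (t : ℕ) then k * (k - 1) + 1 + 2 * ((t : ℕ) - k * (k - 1))
  else if Even (t : ℕ) then (t : ℕ) + 1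
  else 2 * k + ((t : ℕ) - 1)

/-- The `k`-track. -/
def kTrack (k : ℕ) : Equiv.Perm (Fin (k ^ 2)) := reduction (trackSeq k)

/-- The stair-decomposition of the `k`-track into blocks `A_1, …, A_k` of size `k`: the block of
the element at position `t`. The positions are divided into groups of `2k` positions (the last
group has `k` positions for odd `k`), and in the `j`th group the elements of `A_{2j-1}` alternate
with those of `A_{2j}` (for odd `k` the last group is `A_k`). -/
def trackBlock (k : ℕ) (t : Fin (k ^ 2)) : ℕ :=
  if Odd k ∧ k * (k - 1) ≤ (t : ℕ) then k
  else if Even (t : ℕ) then 2 * ((t : ℕ) / (2 * k)) + 1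
  else 2 * ((t : ℕ) / (2 * k)) + 2

/-- The `k`-spiral: the twirl of the `k`-track with respect to its stair-decomposition. -/
def kSpiral (k : ℕ) : Equiv.Perm (Fin (k ^ 2)) := twirl (kTrack k) (trackBlock k)

end PermPattern

namespace PermPattern

theorem sort_symm_lt_iff {n : ℕ} {α : Type*} [LinearOrder α] {f : Fin n → α}
    (hf : Function.Injective f) (i j : Fin n) :
    (Tuple.sort f).symm i < (Tuple.sort f).symm j ↔ f i < f j := by
  have hm : StrictMono (f ∘ Tuple.sort f) :=
    (Tuple.monotone_sort f).strictMono_of_injective (hf.comp (Tuple.sort f).injective)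
  simpa using (hm.lt_iff_lt (a := (Tuple.sort f).symm i) (b := (Tuple.sort f).symm j)).symm

theorem ofPoints_apply_sort_symm {n : ℕ} {α : Type*} [LinearOrder α] (x y : Fin n → α)
    (i : Fin n) : ofPoints x y ((Tuple.sort x).symm i) = (Tuple.sort y).symm i := by
  simp [ofPoints]

theorem group_lt_iff {n a b : ℕ} (ha : a < n) (hb : b < n) (p q : ℕ) :
    (a : ℤ) + n * p < b + n * q ↔ p < q ∨ (p = q ∧ a < b) := by
  rcases lt_trichotomy p q with h | h | h
  · have h1 : (n : ℤ) * (p + 1) ≤ n * q := by exact_mod_cast Nat.mul_le_mul_left n h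
    constructor
    · intro _; exact Or.inl h
    · intro _; nlinarith
  · subst h; simp
  · have h1 : (n : ℤ) * (q + 1) ≤ n * p := by exact_mod_cast Nat.mul_le_mul_left n h
    constructor
    · intro _; nlinarith
    · rintro (h2 | h2) <;> omega

/-- The order of the points of `twirlX` and `twirlY`. -/
theorem twirl_key_lt_iff {n a b : ℕ} (ha : a < n) (hb : b < n) (p q : ℕ) :
    ((if Odd p then toLex (0, (a : ℤ) + n * p) else toLex (1, -((a : ℤ) + n * p)) : ℕ ×ₗ ℤ) <
      if Odd q then toLex (0, (b : ℤ) + n * q) else toLex (1, -((b : ℤ) + n * q))) ↔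
    (Odd p ∧ ¬ Odd q) ∨ (Odd p ∧ Odd q ∧ (p < q ∨ (p = q ∧ a < b))) ∨
      (¬ Odd p ∧ ¬ Odd q ∧ (q < p ∨ (p = q ∧ b < a))) := by
  have h1 := group_lt_iff ha hb p q
  have h2 := group_lt_iff hb ha q p
  by_cases hp : Odd p <;> by_cases hq : Odd q <;>
    simp only [hp, hq, if_true, if_false, Prod.Lex.toLex_lt_toLex, neg_lt_neg_iff, h1, h2] <;>
    simp [eq_comm]

theorem twirlX_lt_iff {n : ℕ} (β : Fin n → ℕ) (i j : Fin n) :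
    twirlX β i < twirlX β j ↔
    (Odd ((β i + 1) / 2) ∧ ¬ Odd ((β j + 1) / 2)) ∨
      (Odd ((β i + 1) / 2) ∧ Odd ((β j + 1) / 2) ∧
        ((β i + 1) / 2 < (β j + 1) / 2 ∨ ((β i + 1) / 2 = (β j + 1) / 2 ∧ (i : ℕ) < j))) ∨
      (¬ Odd ((β i + 1) / 2) ∧ ¬ Odd ((β j + 1) / 2) ∧
        ((β j + 1) / 2 < (β i + 1) / 2 ∨ ((β i + 1) / 2 = (β j + 1) / 2 ∧ (j : ℕ) < i))) :=
  twirl_key_lt_iff i.2 j.2 _ _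

theorem twirlY_lt_iff {n : ℕ} (π : Equiv.Perm (Fin n)) (β : Fin n → ℕ) (i j : Fin n) :
    twirlY π β i < twirlY π β j ↔
    (Odd (β i / 2) ∧ ¬ Odd (β j / 2)) ∨
      (Odd (β i / 2) ∧ Odd (β j / 2) ∧
        (β i / 2 < β j / 2 ∨ (β i / 2 = β j / 2 ∧ (π i : ℕ) < π j))) ∨
      (¬ Odd (β i / 2) ∧ ¬ Odd (β j / 2) ∧
        (β j / 2 < β i / 2 ∨ (β i / 2 = β j / 2 ∧ (π j : ℕ) < π i))) :=
  twirl_key_lt_iff (π i).2 (π j).2 _ _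

theorem twirlX_injective {n : ℕ} (β : Fin n → ℕ) : Function.Injective (twirlX β) := by
  intro i j h
  have h1 := (twirlX_lt_iff β i j).not.1 (by rw [h]; exact lt_irrefl _)
  have h2 := (twirlX_lt_iff β j i).not.1 (by rw [h]; exact lt_irrefl _)
  simp only [Nat.odd_iff] at h1 h2
  apply Fin.ext
  omega

theorem twirlY_injective {n : ℕ} (π : Equiv.Perm (Fin n)) (β : Fin n → ℕ) :
    Function.Injective (twirlY π β) := by
  intro i j h
  have h1 := (twirlY_lt_iff π β i j).not.1 (by rw [h]; exact lt_irrefl _)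
  have h2 := (twirlY_lt_iff π β j i).not.1 (by rw [h]; exact lt_irrefl _)
  simp only [Nat.odd_iff] at h1 h2
  apply π.injective
  apply Fin.ext
  omega

theorem isTwirl_of_lt_iff {n : ℕ} {π : Equiv.Perm (Fin n)} {m : ℕ} {β : Fin n → ℕ}
    (h : IsStairDecomp π m β) {π' e : Equiv.Perm (Fin n)}
    (hx : ∀ i j, e i < e j ↔ twirlX β i < twirlX β j)
    (hy : ∀ i j, π' (e i) < π' (e j) ↔ twirlY π β i < twirlY π β j) :
    IsTwirl π m β π' (β ∘ e.symm) e := by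
  have inc : ∀ i j, β i = β j → ((i : ℕ) < j ↔ (π i : ℕ) < π j) := by
    intro i j hij
    have h1 := h.increasing i j hij
    have h2 := h.increasing j i hij.symm
    rcases lt_trichotomy i j with h3 | h3 | h3
    · exact ⟨fun _ => h1 h3, fun _ => h3⟩
    · subst h3; simp
    · have h4 : (π j : ℕ) < π i := h2 h3
      have h5 : (j : ℕ) < i := h3
      omega
  simp only [twirlX_lt_iff, twirlY_lt_iff, Nat.odd_iff] at hx hy
  have spiral : IsSpiralDecomp π' m (β ∘ e.symm) := by
    refine ⟨fun i => h.range _, ?_, ?_, ?_, ?_, ?_, ?_, ?_, ?_, ?_, ?_⟩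
    all_goals
      intro i j
      obtain ⟨i, rfl⟩ := e.surjective i
      obtain ⟨j, rfl⟩ := e.surjective j
      have h5 := inc i j
      have h5b := inc j i
      have h6 := h.range i
      simp only [Nat.odd_iff, Nat.even_iff, Function.comp_apply, Equiv.symm_apply_apply, hx, hy]
      generalize (β i) = b at *
      generalize (β j) = c at *
      generalize (i : ℕ) = b1 at *
      generalize (j : ℕ) = c1 at *
      generalize ((π i : Fin n) : ℕ) = b2 at *
      generalize ((π j : Fin n) : ℕ) = c2 at *
      clear hx hy inc h
      omega
  refine ⟨spiral, fun i => by simp, ?_, ?_, ?_, ?_, ?_, ?_, ?_, ?_⟩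
  all_goals
    intro i j
    have h5 := inc i j
    have h6 := h.range i
    simp only [hx, hy]
    simp only [Fin.lt_def]
    generalize (β i) = b at *
    generalize (β j) = c at *
    generalize (i : ℕ) = b1 at *
    generalize (j : ℕ) = c1 at *
    generalize ((π i : Fin n) : ℕ) = b2 at *
    generalize ((π j : Fin n) : ℕ) = c2 at *
    clear hx hy inc h spiral
    omega

/-- The permutation `twirl π β` obeys the rules that define the twirl. -/
theorem isTwirl_twirl {n : ℕ} {π : Equiv.Perm (Fin n)} {m : ℕ} {β : Fin n → ℕ}
    (h : IsStairDecomp π m β) :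
    IsTwirl π m β (twirl π β) (β ∘ Tuple.sort (twirlX β)) (Tuple.sort (twirlX β)).symm := by
  refine isTwirl_of_lt_iff h (fun i j => sort_symm_lt_iff (twirlX_injective β) i j) fun i j => ?_
  rw [twirl, ofPoints_apply_sort_symm, ofPoints_apply_sort_symm]
  exact sort_symm_lt_iff (twirlY_injective π β) i j

end PermPattern

namespace PermPattern

theorem track_cases (k : ℕ) (t : Fin (k ^ 2)) : ∃ g s : ℕ, (t : ℕ) = 2 * k * g + s ∧ s < 2 * k ∧
    ((k = 2 * g + 1 ∧ s < k ∧ trackBlock k t = 2 * g + 1 ∧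
        trackSeq k t = 2 * k * g + 1 + 2 * s) ∨
      (2 * g + 2 ≤ k ∧ s % 2 = 0 ∧ trackBlock k t = 2 * g + 1 ∧
        trackSeq k t = 2 * k * g + s + 1) ∨
      (2 * g + 2 ≤ k ∧ s % 2 = 1 ∧ trackBlock k t = 2 * g + 2 ∧
        trackSeq k t = 2 * k * g + 2 * k + s - 1)) := by
  have ht : (t : ℕ) < k * k := by simpa [pow_two] using t.2
  have hk : 0 < 2 * k := by
    rcases Nat.eq_zero_or_pos k with h | h
    · subst h; omega
    · omega
  have hts := Nat.div_add_mod (t : ℕ) (2 * k)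
  have hs := Nat.mod_lt (t : ℕ) hk
  refine ⟨(t : ℕ) / (2 * k), (t : ℕ) % (2 * k), hts.symm, hs, ?_⟩
  unfold trackBlock trackSeq
  generalize hg : (t : ℕ) / (2 * k) = g at *
  generalize (t : ℕ) % (2 * k) = s at *
  have hpar : (2 * k * g) % 2 = 0 := by rw [mul_assoc]; omega
  by_cases hodd : Odd k
  · obtain ⟨h, hh⟩ := hodd
    have hM : k * (k - 1) = 2 * k * h := by
      have : k - 1 = 2 * h := by omega
      rw [this]; ring
    have hodd : Odd k := ⟨h, hh⟩
    have hkk : k * k = 2 * k * h + k := by rw [hh]; ring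
    by_cases hl : k * (k - 1) ≤ (t : ℕ)
    · have hgh : g = h := by
        rcases lt_trichotomy g h with h1 | h1 | h1
        · have := Nat.mul_le_mul_left (2 * k) h1
          rw [Nat.mul_succ] at this
          omega
        · exact h1
        · have := Nat.mul_le_mul_left (2 * k) h1
          rw [Nat.mul_succ] at this
          omega
      subst hgh
      left
      simp only [hodd, hl, and_self, if_true]
      refine ⟨hh, by omega, hh, ?_⟩
      omega
    · have hgh : g < h := by
        by_contra h1
        have := Nat.mul_le_mul_left (2 * k) (not_lt.1 h1)
        omega
      right
      simp only [hodd, hl, and_false, if_false, Nat.even_iff]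
      split_ifs <;> omega
  · right
    have hgk : g < k / 2 := by
      by_contra h1
      have := Nat.mul_le_mul_left (2 * k) (not_lt.1 h1)
      have h2 : k = 2 * (k / 2) := by
        have := Nat.not_odd_iff_even.1 hodd
        have := Nat.even_iff.1 this
        omega
      have h3 : 2 * k * (k / 2) = k * k := by
        calc 2 * k * (k / 2) = k * (2 * (k / 2)) := by ring
          _ = k * k := by rw [← h2]
      omega
    simp only [hodd, false_and, if_false, Nat.even_iff]
    split_ifs <;> omega

theorem trackSeq_injective (k : ℕ) : Function.Injective (trackSeq k) := by
  intro t t' h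
  obtain ⟨g, s, h1, h2, h3⟩ := track_cases k t
  obtain ⟨g', s', h1', h2', h3'⟩ := track_cases k t'
  have hpar : (2 * k * g) % 2 = 0 := by rw [mul_assoc]; omega
  have hpar' : (2 * k * g') % 2 = 0 := by rw [mul_assoc]; omega
  apply Fin.ext
  rcases lt_trichotomy g g' with h4 | h4 | h4
  · have := Nat.mul_le_mul_left (2 * k) h4
    rw [Nat.mul_succ] at this
    omega
  · subst h4
    omega
  · have := Nat.mul_le_mul_left (2 * k) h4
    rw [Nat.mul_succ] at this
    omega

/-- The blocks given by `trackBlock` form a stair-decomposition of the `k`-track. -/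
theorem isStairDecomp_trackBlock (k : ℕ) : IsStairDecomp (kTrack k) k (trackBlock k) := by
  have hlt : ∀ i j, kTrack k i < kTrack k j ↔ trackSeq k i < trackSeq k j :=
    sort_symm_lt_iff (trackSeq_injective k)
  refine ⟨fun i => ?_, ?_, ?_, ?_, ?_⟩
  · obtain ⟨g, s, h1, h2, h3⟩ := track_cases k i
    omega
  all_goals
    intro i j
    simp only [hlt, Fin.lt_def, Nat.odd_iff, Nat.even_iff]
    obtain ⟨g, s, h1, h2, h3⟩ := track_cases k i
    obtain ⟨g', s', h1', h2', h3'⟩ := track_cases k j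
    have hpar : (2 * k * g) % 2 = 0 := by rw [mul_assoc]; omega
    have hpar' : (2 * k * g') % 2 = 0 := by rw [mul_assoc]; omega
    by_cases h4 : g' = g
    · subst h4
      omega
    · by_cases h5 : g' = g + 1
      · subst h5
        have h6 : 2 * k * (g + 1) = 2 * k * g + 2 * k := by ring
        rw [h6] at h1' h3' hpar'
        generalize 2 * k * g = P at *
        omega
      · omega

end PermPattern

namespace PermPattern

/-! Avoiding 2143 and 3412 gives the diagram a center: two lines cut it into four monotone arms, so
points of an arm have an unambiguous order of depth (`exists_isCenter`, `centerKey_succ`).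
Cyclically neighbouring arms share rows or columns, and their points are compared by depth there.
Avoiding 3142 forbids four points, one per arm, that get deeper all the way round
(`center_acyclic`). Hence a greedy spiral, which always moves to the outermost point of the next arm
that is deeper than the current point, makes strict progress at every turn. It cuts the arms into
blocks numbered along the spiral.

The spiral can be unrolled: a single injective time function realizes the depth orders of all pairs
of consecutive blocks (`SpiralSystem.exists_time`), so the points fill a strip with coordinates
block and time. Apart from two vertices next to the center lines, every edge of `permGraph π` joins
points adjacent in the time order of two consecutive blocks, or has an end that is first in its
block and spans at most four blocks (`isStripGraph_permGraph`).

Height in the strip is measured by waves. If a wave of height linear in `k` misses a block, a zigzag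
route with few points crosses the strip in the time direction; with nearby first points it separates
left from right (`exists_separates_of_wave_eq_empty`). A wall yields many rows and columns that meet
pairwise, so a small separator leaves all surviving rows on one side. If every window of `k` blocks
had such a separator, the rows would be to the right of the first one and to the left of the last
one, yet they cannot change sides between two nearby ones, because the narrow region in between can
be swept in time by small separators (`inside_of_inside`).

So `k` consecutive blocks all have high waves. The first points of suitable waves form a `k` by `k`
grid ordered like the track (`exists_isTrackGrid`), and wound up again around the center this grid
is the spiral or its rotation (`contains_kSpiral_of_isTrackGrid`). All bounds are linear in `k`. -/

/-! ### Linked sets and rows and columns of walls -/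

/-- A set of vertices on which every property preserved by adjacency inside the set is constant,
that is, a set that induces a connected subgraph (or is empty). -/
def Linked {V : Type*} (G : SimpleGraph V) (K : Set V) : Prop :=
  ∀ P : V → Prop, (∀ x ∈ K, ∀ y ∈ K, G.Adj x y → P x → P y) → ∀ x ∈ K, ∀ y ∈ K, P x → P y

theorem walk_start_iff {V : Type*} {G : SimpleGraph V} {K : Set V} {P : V → Prop}
    (hP : ∀ x ∈ K, ∀ y ∈ K, G.Adj x y → P x → P y) {u v : V} (p : G.Walk u v)
    (hK : ∀ x ∈ p.support, x ∈ K) : ∀ x ∈ p.support, P u ↔ P x := by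
  induction p with
  | nil => intro x hx; simp at hx; rw [hx]
  | @cons a b c h q ih =>
    intro x hx
    rw [SimpleGraph.Walk.support_cons] at hx hK
    have ha : a ∈ K := hK a (by simp)
    have hb : b ∈ K := hK b (List.mem_cons_of_mem _ q.start_mem_support)
    have hab : P a ↔ P b := ⟨hP a ha b hb h, hP b hb a ha h.symm⟩
    rcases List.mem_cons.1 hx with rfl | hx
    · rfl
    · exact hab.trans (ih (fun y hy => hK y (List.mem_cons_of_mem _ hy)) x hx)

/-- The vertices of the subdivided path in `G` of a path `c 0, …, c N` in `H`. -/
def pathVerts {V W : Type*} {G : SimpleGraph V} {H : SimpleGraph W} {φ : W → V}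
    (P : ∀ u v : W, H.Adj u v → G.Walk (φ u) (φ v)) (c : ℕ → W) (N : ℕ) : Set V :=
  {x | ∃ n, n < N ∧ ∃ h : H.Adj (c n) (c (n + 1)), x ∈ (P _ _ h).support}

theorem linked_pathVerts {V W : Type*} {G : SimpleGraph V} {H : SimpleGraph W} {φ : W → V}
    (P : ∀ u v : W, H.Adj u v → G.Walk (φ u) (φ v)) {c : ℕ → W} {N : ℕ}
    (hc : ∀ n < N, H.Adj (c n) (c (n + 1))) : Linked G (pathVerts P c N) := by
  intro Q hQ
  have key : ∀ n (hn : n < N), ∀ x ∈ (P _ _ (hc n hn)).support, Q (φ (c n)) ↔ Q x := fun n hn =>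
    walk_start_iff hQ (P _ _ (hc n hn)) fun x hx => ⟨n, hn, hc n hn, hx⟩
  have base : ∀ n, n ≤ N → (Q (φ (c 0)) ↔ Q (φ (c n))) := by
    intro n
    induction n with
    | zero => intro _; rfl
    | succ n ih =>
      intro hn
      exact (ih (by omega)).trans (key n hn _ (P _ _ (hc n hn)).end_mem_support)
  rintro x ⟨n, hn, h, hx⟩ y ⟨m, hm, h', hy⟩ hq
  exact (key m hm y hy).1 ((base m hm.le).1 ((base n hn.le).2 ((key n hn x hx).2 hq)))

/-- Subdivided edges can meet only in a common branch vertex, so vertex-disjoint paths of `H` stay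
disjoint after subdivision. -/
theorem disjoint_pathVerts {V W : Type*} {G : SimpleGraph V} {H : SimpleGraph W} {φ : W → V}
    (P : ∀ u v : W, H.Adj u v → G.Walk (φ u) (φ v))
    (hP : ∀ u v (h : H.Adj u v) u' v' (h' : H.Adj u' v'), s(u, v) ≠ s(u', v') →
      ∀ x, x ∈ (P u v h).support → x ∈ (P u' v' h').support →
        ∃ w, x = φ w ∧ (w = u ∨ w = v) ∧ (w = u' ∨ w = v'))
    {c c' : ℕ → W} {N : ℕ} (hcc : ∀ n ≤ N, ∀ m ≤ N, c n ≠ c' m) :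
    Disjoint (pathVerts P c N) (pathVerts P c' N) := by
  rw [Set.disjoint_left]
  rintro x ⟨n, hn, h, hx⟩ ⟨m, hm, h', hx'⟩
  have h1 := hcc n hn.le m hm.le
  have h2 := hcc n hn.le (m + 1) hm
  have h3 := hcc (n + 1) hn m hm.le
  have h4 := hcc (n + 1) hn (m + 1) hm
  obtain ⟨w, -, hw, hw'⟩ := hP _ _ h _ _ h' (by
    intro e
    rcases Sym2.eq_iff.1 e with e | e
    · exact h1 e.1
    · exact h2 e.1) x hx hx'
  rcases hw with rfl | rfl <;> rcases hw' with e | e <;> contradiction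

/-- `m` disjoint linked sets, the rows, and `m` disjoint linked sets, the columns, such that every
row meets every column. -/
structure IsMesh {V : Type*} (G : SimpleGraph V) (m : ℕ) (R C : ℕ → Set V) : Prop where
  row_linked : ∀ i < m, Linked G (R i)
  col_linked : ∀ i < m, Linked G (C i)
  row_disjoint : ∀ i < m, ∀ j < m, i ≠ j → Disjoint (R i) (R j)
  col_disjoint : ∀ i < m, ∀ j < m, i ≠ j → Disjoint (C i) (C j)
  meet : ∀ i < m, ∀ j < m, (R i ∩ C j).Nonempty

/-- The rows are horizontal lines of the wall; each column zigzags between two neighbouring vertical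
lines. -/
theorem exists_isMesh_of_containsWall {V : Type*} {G : SimpleGraph V} {r : ℕ} (hr : 2 ≤ r)
    (h : ContainsWall G r) : ∃ R C, IsMesh G (r - 1) R C := by
  obtain ⟨φ, P, -, -, -, -, hP⟩ := h
  have w₀ : WallVertex r := ⟨(1, 1), by simp; omega⟩
  -- Dropping the outermost vertical lines avoids both missing corners; `w₀` only fills arguments
  -- out of range.
  let mk (i j : ℕ) : WallVertex r :=
    if h : (1 ≤ i ∧ i ≤ r + 1) ∧ (2 ≤ j ∧ j ≤ 2 * r + 1) then
      ⟨(i, j), h.1, by omega, by simp; omega, by simp; omega⟩ else w₀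
  have hmk : ∀ i j, (1 ≤ i ∧ i ≤ r + 1) ∧ (2 ≤ j ∧ j ≤ 2 * r + 1) → (mk i j).1 = (i, j) := by
    intro i j h
    have e : mk i j = ⟨(i, j), h.1, by omega, by simp; omega, by simp; omega⟩ := dif_pos h
    rw [e]
  let row (i n : ℕ) : WallVertex r := mk (i + 1) (n + 2)
  -- Surviving vertical edges leave odd rows at odd second coordinates and even rows at even ones,
  -- so the path changes sides in every row.
  let col (j n : ℕ) : WallVertex r :=
    mk (n / 2 + 1) (if n % 4 = 0 ∨ n % 4 = 3 then 2 * j + 4 else 2 * j + 3)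
  have hrow : ∀ i < r - 1, ∀ n ≤ 2 * r - 1, (row i n).1 = (i + 1, n + 2) := fun i hi n hn =>
    hmk _ _ (by omega)
  have hcol : ∀ j < r - 1, ∀ n ≤ 2 * r - 1, (col j n).1 =
      (n / 2 + 1, if n % 4 = 0 ∨ n % 4 = 3 then 2 * j + 4 else 2 * j + 3) := fun j hj n hn =>
    hmk _ _ (by split_ifs <;> omega)
  have hrowadj : ∀ i < r - 1, ∀ n < 2 * r - 1,
      (elementaryWall r).Adj (row i n) (row i (n + 1)) := by
    intro i hi n hn
    simp only [elementaryWall, WallRemoved, hrow i hi n hn.le, hrow i hi (n + 1) hn, Nat.dist]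
    omega
  have hcoladj : ∀ j < r - 1, ∀ n < 2 * r - 1,
      (elementaryWall r).Adj (col j n) (col j (n + 1)) := by
    intro j hj n hn
    simp only [elementaryWall, WallRemoved, hcol j hj n hn.le, hcol j hj (n + 1) hn, Nat.dist,
      Nat.odd_iff, Nat.even_iff]
    split_ifs <;> omega
  refine ⟨fun i => pathVerts P (row i) (2 * r - 1), fun j => pathVerts P (col j) (2 * r - 1),
    fun i hi => linked_pathVerts P (hrowadj i hi), fun j hj => linked_pathVerts P (hcoladj j hj),
    ?_, ?_, ?_⟩
  · intro i hi j hj hij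
    refine disjoint_pathVerts P hP fun n hn m hm e => ?_
    have e := congrArg Subtype.val e
    rw [hrow i hi n hn, hrow j hj m hm] at e
    simp at e
    omega
  · intro i hi j hj hij
    refine disjoint_pathVerts P hP fun n hn m hm e => ?_
    have e := congrArg Subtype.val e
    rw [hcol i hi n hn, hcol j hj m hm, Prod.mk.injEq] at e
    have e := e.2
    split_ifs at e <;> omega
  · intro i hi j hj
    have hi2 : 2 * i < 2 * r - 1 := by omega
    have hj2 : (if i % 2 = 0 then 2 * j + 2 else 2 * j + 1) < 2 * r - 1 := by split_ifs <;> omega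
    refine ⟨φ (col j (2 * i)), ⟨_, hj2, hrowadj i hi _ hj2, ?_⟩,
      ⟨2 * i, hi2, hcoladj j hj _ hi2, (P _ _ _).start_mem_support⟩⟩
    have e : col j (2 * i) = row i (if i % 2 = 0 then 2 * j + 2 else 2 * j + 1) := by
      apply Subtype.ext
      rw [hrow i hi _ hj2.le, hcol j hj _ hi2.le]
      simp only [Prod.mk.injEq]
      split_ifs <;> omega
    rw [e]
    exact (P _ _ _).start_mem_support

/-! ### Small separators and the side on which the rows lie -/

/-- `X` separates `S` from its complement. -/
def Separates {V : Type*} (G : SimpleGraph V) (X : Finset V) (S : Set V) : Prop :=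
  ∀ x y, x ∉ X → y ∉ X → G.Adj x y → x ∈ S → y ∈ S

theorem exists_disjoint_of_card_lt {V : Type*} {m : ℕ} {R : ℕ → Set V}
    (hR : ∀ i < m, ∀ j < m, i ≠ j → Disjoint (R i) (R j)) {X : Finset V} (hX : X.card < m) :
    ∃ i < m, ∀ x ∈ R i, x ∉ X := by
  classical
  by_contra! hcon
  have hm : ∀ i : Fin m, ∃ x ∈ R i, x ∈ X := fun i => hcon i i.2
  choose f hf hfX using hm
  have := Finset.card_le_card_of_injOn (s := Finset.univ) (t := X) f (fun i _ => hfX i) (by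
    intro i _ j _ hij
    by_contra hne
    exact Set.disjoint_left.1 (hR i i.2 j j.2 (fun h => hne (Fin.ext h))) (hf i) (hij ▸ hf j))
  simp at this
  omega

namespace IsMesh

variable {V : Type*} {G : SimpleGraph V} {m : ℕ} {R C : ℕ → Set V}

/-- A row that avoids `X` is contained in `S`. -/
def Inside (m : ℕ) (R : ℕ → Set V) (X : Finset V) (S : Set V) : Prop :=
  ∃ i < m, (∀ x ∈ R i, x ∉ X) ∧ R i ⊆ S

theorem exists_row (h : IsMesh G m R C) {X : Finset V} (hX : X.card < m) :
    ∃ i < m, ∀ x ∈ R i, x ∉ X := exists_disjoint_of_card_lt h.row_disjoint hX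

/-- Some column avoids `X` as well, and it ties any two rows that avoid `X` to the same side. -/
theorem row_subset (h : IsMesh G m R C) {X : Finset V} {S : Set V} (hS : Separates G X S)
    (hX : X.card < m) (hin : Inside m R X S) {i : ℕ} (hi : i < m) (hiX : ∀ x ∈ R i, x ∉ X) :
    R i ⊆ S := by
  obtain ⟨j, hj, hjX, hjS⟩ := hin
  obtain ⟨l, hl, hlX⟩ := exists_disjoint_of_card_lt h.col_disjoint hX
  obtain ⟨a, haj, hal⟩ := h.meet j hj l hl
  obtain ⟨b, hbi, hbl⟩ := h.meet i hi l hl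
  have hb : b ∈ S := h.col_linked l hl (· ∈ S)
    (fun x hx y hy hxy => hS x y (hlX x hx) (hlX y hy) hxy) a hal b hbl (hjS haj)
  intro x hx
  exact h.row_linked i hi (· ∈ S)
    (fun x hx y hy hxy => hS x y (hiX x hx) (hiX y hy) hxy) b hbi x hx hb

theorem row_not_mem (h : IsMesh G m R C) {X : Finset V} {S : Set V} (hS : Separates G X S)
    (hin : ¬ Inside m R X S) {i : ℕ} (hi : i < m) (hiX : ∀ x ∈ R i, x ∉ X) :
    ∀ x ∈ R i, x ∉ S := by
  intro x hx hxS
  exact hin ⟨i, hi, hiX, fun y hy => h.row_linked i hi (· ∈ S)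
    (fun x hx y hy hxy => hS x y (hiX x hx) (hiX y hy) hxy) x hx y hy hxS⟩

end IsMesh

end PermPattern

namespace PermPattern

/-! ### Spiralling systems

Points in four cyclically ordered arms; points in arms `i` and `i + 1` are compared by their depth
`key i`, and there is no cycle of points, each deeper than the one before it, around the arms. -/

/-- Indices of arms and of keys are read modulo `4`. -/
structure SpiralSystem (V : Type*) where
  arm : V → ℕ
  key : ℕ → V → ℕ
  key_mod : ∀ i z, key (i + 4) z = key i z
  key_inj : ∀ i x y, (arm x % 4 = i % 4 ∨ arm x % 4 = (i + 1) % 4) →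
    (arm y % 4 = i % 4 ∨ arm y % 4 = (i + 1) % 4) → key i x = key i y → x = y
  key_succ : ∀ i x y, arm x % 4 = (i + 1) % 4 → arm y % 4 = (i + 1) % 4 →
    (key i x < key i y ↔ key (i + 1) x < key (i + 1) y)
  acyclic : ∀ i a b c d, arm a % 4 = i % 4 → arm b % 4 = (i + 1) % 4 → arm c % 4 = (i + 2) % 4 →
    arm d % 4 = (i + 3) % 4 → key i a < key i b → key (i + 1) b < key (i + 1) c →
    key (i + 2) c < key (i + 2) d → ¬ key (i + 3) d < key (i + 3) a

namespace SpiralSystem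

variable {V : Type*} (Y : SpiralSystem V)

theorem key_congr {i j : ℕ} (h : i % 4 = j % 4) (z : V) : Y.key i z = Y.key j z := by
  have aux : ∀ i m, Y.key (i + 4 * m) z = Y.key i z := by
    intro i m
    induction m with
    | zero => rfl
    | succ m ih => rw [Nat.mul_succ, ← add_assoc, Y.key_mod, ih]
  rw [← Nat.mod_add_div i 4, ← Nat.mod_add_div j 4, aux, aux, h]

/-- The points of arm `i` from the `i`th point of a greedy spiral on. -/
def upper : ℕ → Set V
  | 0 => {z | Y.arm z % 4 = 0}
  | i + 1 => {z | Y.arm z % 4 = (i + 1) % 4 ∧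
      (i < 4 ∨ ∃ x ∈ upper i, Y.key i x < Y.key i z)}

theorem arm_of_mem_upper {i : ℕ} {z : V} (h : z ∈ Y.upper i) : Y.arm z % 4 = i % 4 := by
  cases i with
  | zero => exact h
  | succ i => exact h.1

theorem mem_upper_of_le {i : ℕ} {z : V} (hi : i ≤ 4) (h : Y.arm z % 4 = i % 4) :
    z ∈ Y.upper i := by
  cases i with
  | zero => exact h
  | succ i => exact ⟨h, Or.inl (by omega)⟩

theorem mem_upper_succ {i : ℕ} {x z : V} (hx : x ∈ Y.upper i) (hz : Y.arm z % 4 = (i + 1) % 4)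
    (h : Y.key i x < Y.key i z) : z ∈ Y.upper (i + 1) := ⟨hz, Or.inr ⟨x, hx, h⟩⟩

theorem exists_of_mem_upper_succ {i : ℕ} {z : V} (hi : 4 ≤ i) (hz : z ∈ Y.upper (i + 1)) :
    ∃ x ∈ Y.upper i, Y.key i x < Y.key i z := by
  rcases hz.2 with h | h
  · omega
  · exact h

theorem upper_mono {i : ℕ} {x y : V} (hx : x ∈ Y.upper i) (hy : Y.arm y % 4 = i % 4)
    (h : Y.key i x ≤ Y.key i y) : y ∈ Y.upper i := by
  cases i with
  | zero => exact hy
  | succ i =>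
    refine ⟨hy, ?_⟩
    rcases hx.2 with h1 | ⟨w, hw, hwx⟩
    · exact Or.inl h1
    · refine Or.inr ⟨w, hw, ?_⟩
      have := (Y.key_succ i y x hy hx.1).not.2 (not_lt.2 h)
      omega

theorem upper_add_four (i : ℕ) : Y.upper (i + 4) ⊆ Y.upper i := by
  induction i with
  | zero =>
    intro z hz
    have := Y.arm_of_mem_upper hz
    exact Y.mem_upper_of_le (by omega) (by omega)
  | succ i ih =>
    intro z hz
    have hz4 : Y.arm z % 4 = (i + 1) % 4 := by
      have := Y.arm_of_mem_upper hz
      omega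
    obtain ⟨x, hx, hxz⟩ := Y.exists_of_mem_upper_succ (by omega : 4 ≤ i + 4) hz
    rw [Y.key_mod, Y.key_mod] at hxz
    exact Y.mem_upper_succ (ih hx) hz4 hxz

theorem upper_antitone {i j : ℕ} (hij : i ≤ j) (h : i % 4 = j % 4) : Y.upper j ⊆ Y.upper i := by
  have aux : ∀ m, Y.upper (i + 4 * m) ⊆ Y.upper i := by
    intro m
    induction m with
    | zero => exact subset_rfl
    | succ m ih => exact (Y.upper_add_four _).trans ih
  have e : j = i + 4 * ((j - i) / 4) := by omega
  rw [e]
  exact aux _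

/-- The first point of `upper i`. -/
def IsFirst (i : ℕ) (z : V) : Prop := z ∈ Y.upper i ∧ ∀ y ∈ Y.upper i, Y.key i z ≤ Y.key i y

variable {Y}

theorem IsFirst.eq {i : ℕ} {x y : V} (hx : Y.IsFirst i x) (hy : Y.IsFirst i y) : x = y :=
  Y.key_inj i x y (Or.inl (Y.arm_of_mem_upper hx.1)) (Or.inl (Y.arm_of_mem_upper hy.1))
    (le_antisymm (hx.2 y hy.1) (hy.2 x hx.1))

/-- Strict progress of the spiral: if `x` survived a full turn, tracing its predecessors back
through the arms and replacing the last one by the outermost point `x` would give a cycle excluded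
by `acyclic`. -/
theorem IsFirst.not_mem_upper {i : ℕ} {x : V} (hi : 4 ≤ i) (hx : Y.IsFirst i x) :
    x ∉ Y.upper (i + 4) := by
  intro h
  obtain ⟨d, hd, hdx⟩ := Y.exists_of_mem_upper_succ (by omega) h
  obtain ⟨c, hc, hcd⟩ := Y.exists_of_mem_upper_succ (by omega) hd
  obtain ⟨b, hb, hbc⟩ := Y.exists_of_mem_upper_succ (by omega) hc
  obtain ⟨a, ha, hab⟩ := Y.exists_of_mem_upper_succ (by omega) hb
  exact Y.acyclic i x b c d (Y.arm_of_mem_upper hx.1) (Y.arm_of_mem_upper hb)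
    (Y.arm_of_mem_upper hc) (Y.arm_of_mem_upper hd) ((hx.2 a ha).trans_lt hab) hbc hcd hdx

variable (Y)

theorem exists_isFirst [Finite V] {i : ℕ} (h : (Y.upper i).Nonempty) : ∃ z, Y.IsFirst i z := by
  obtain ⟨z, hz, hmin⟩ := Set.exists_min_image (Y.upper i) (Y.key i) (Set.toFinite _) h
  exact ⟨z, hz, hmin⟩

theorem ncard_upper_lt [Finite V] {i : ℕ} (hi : 4 ≤ i) (h : (Y.upper i).Nonempty) :
    (Y.upper (i + 4)).ncard < (Y.upper i).ncard := by
  obtain ⟨z, hz⟩ := Y.exists_isFirst h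
  exact Set.ncard_lt_ncard ⟨Y.upper_add_four i, fun hs => hz.not_mem_upper hi (hs hz.1)⟩
    (Set.toFinite _)

/-- Each further turn loses at least its first point. -/
theorem exists_bound [Finite V] : ∃ N, ∀ i ≥ N, Y.upper i = ∅ := by
  have aux : ∀ m i, 4 ≤ i → (Y.upper (i + 4 * m)).ncard + m ≤ Nat.card V ∨
      Y.upper (i + 4 * m) = ∅ := by
    intro m i hi
    induction m with
    | zero => exact Or.inl (Set.ncard_le_card _)
    | succ m ih =>
      rcases Set.eq_empty_or_nonempty (Y.upper (i + 4 * m)) with h | h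
      · exact Or.inr (Set.subset_empty_iff.1 ((Y.upper_add_four _).trans h.subset))
      · have h1 := Y.ncard_upper_lt (by omega) h
        rcases ih with h2 | h2
        · left
          rw [show i + 4 * (m + 1) = i + 4 * m + 4 by ring]
          omega
        · exact absurd h (by rw [h2]; simp)
  refine ⟨4 + 4 * (Nat.card V + 1), fun i hi => ?_⟩
  have h := aux (Nat.card V + 1) (i - 4 * (Nat.card V + 1)) (by omega)
  rw [Nat.sub_add_cancel (by omega)] at h
  rcases h with h | h
  · omega
  · exact h

theorem exists_block [Finite V] (z : V) : ∃ i, z ∈ Y.upper i ∧ z ∉ Y.upper (i + 4) := by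
  by_contra! hcon
  obtain ⟨N, hN⟩ := Y.exists_bound
  have aux : ∀ m, z ∈ Y.upper (Y.arm z % 4 + 4 * m) := by
    intro m
    induction m with
    | zero => exact Y.mem_upper_of_le (by omega) (by omega)
    | succ m ih => exact hcon _ ih
  have := aux N
  rw [hN _ (by omega)] at this
  exact this

/-- The index of the block of a point. -/
noncomputable def block [Finite V] (z : V) : ℕ := (Y.exists_block z).choose

theorem mem_upper_block [Finite V] (z : V) : z ∈ Y.upper (Y.block z) :=
  (Y.exists_block z).choose_spec.1

theorem not_mem_upper_block_add_four [Finite V] (z : V) : z ∉ Y.upper (Y.block z + 4) :=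
  (Y.exists_block z).choose_spec.2

theorem arm_mod [Finite V] (z : V) : Y.arm z % 4 = Y.block z % 4 :=
  Y.arm_of_mem_upper (Y.mem_upper_block z)

theorem mem_upper_iff [Finite V] {i : ℕ} {z : V} :
    z ∈ Y.upper i ↔ i % 4 = Y.block z % 4 ∧ i ≤ Y.block z := by
  constructor
  · intro h
    have h1 : i % 4 = Y.block z % 4 := by rw [← Y.arm_mod, Y.arm_of_mem_upper h]
    refine ⟨h1, ?_⟩
    by_contra hlt
    exact Y.not_mem_upper_block_add_four z (Y.upper_antitone (by omega) (by omega) h)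
  · rintro ⟨h1, h2⟩
    exact Y.upper_antitone h2 h1 (Y.mem_upper_block z)

/-- Index `0` is empty as a block, since the sets `upper 0` and `upper 4` both consist of the whole
arm `0`. -/
theorem block_pos [Finite V] (z : V) : 1 ≤ Y.block z := by
  by_contra h
  have h0 : Y.block z = 0 := by omega
  have h1 := Y.not_mem_upper_block_add_four z
  have h2 := Y.arm_mod z
  rw [h0] at h1 h2
  exact h1 (Y.mem_upper_of_le (by omega) (by omega))

/-- The pairs of consecutive blocks of a turn of the spiral are outside those of later turns. -/
theorem key_lt_of_block_lt [Finite V] {i j : ℕ} {x y : V} (hij : i < j) (hmod : i % 4 = j % 4)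
    (hx : Y.block x = i ∨ Y.block x = i + 1) (hy : Y.block y = j ∨ Y.block y = j + 1) :
    Y.key i x < Y.key i y := by
  have ax := Y.arm_mod x
  have ay := Y.arm_mod y
  by_contra hle
  have hyx : Y.key i y < Y.key i x := by
    refine lt_of_le_of_ne (not_lt.1 hle) fun e => ?_
    have := Y.key_inj i y x (by omega) (by omega) e
    subst this
    omega
  rcases hx with hx | hx <;> rcases hy with hy | hy
  · have h1 := (Y.mem_upper_iff (z := y) (i := i + 4)).2 (by omega)
    have h2 := Y.upper_mono h1 (y := x) (by omega) (by rw [Y.key_mod, Y.key_mod]; exact hyx.le)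
    have := Y.mem_upper_iff.1 h2
    omega
  · have h1 := (Y.mem_upper_iff (z := y) (i := i + 4 + 1)).2 (by omega)
    obtain ⟨w, hw, hwy⟩ := Y.exists_of_mem_upper_succ (by omega) h1
    have h2 := Y.upper_mono hw (y := x) (by omega) (by
      rw [Y.key_mod, Y.key_mod] at *; omega)
    have := Y.mem_upper_iff.1 h2
    omega
  · have h1 := (Y.mem_upper_iff (z := y) (i := i + 4)).2 (by omega)
    have h2 := Y.mem_upper_succ h1 (z := x) (by omega) (by rw [Y.key_mod, Y.key_mod]; exact hyx)
    have := Y.mem_upper_iff.1 h2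
    omega
  · have h1 := (Y.mem_upper_iff (z := y) (i := i + 4 + 1)).2 (by omega)
    have h2 := Y.upper_mono h1 (y := x) (by omega) (by
      rw [Y.key_congr (show (i + 4 + 1) % 4 = (i + 1) % 4 by omega),
        Y.key_congr (show (i + 4 + 1) % 4 = (i + 1) % 4 by omega)]
      exact ((Y.key_succ i y x (by omega) (by omega)).1 hyx).le)
    have := Y.mem_upper_iff.1 h2
    omega

/-- The points that are first in their blocks. -/
def IsChain [Finite V] (z : V) : Prop := Y.IsFirst (Y.block z) z

theorem isChain_of_isFirst [Finite V] {i : ℕ} {z : V} (hi : 4 ≤ i) (h : Y.IsFirst i z) :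
    Y.IsChain z ∧ Y.block z = i := by
  have e : Y.block z = i := by
    have h1 := Y.mem_upper_iff.1 h.1
    have h2 := mt Y.mem_upper_iff.2 (h.not_mem_upper hi)
    omega
  exact ⟨by rw [IsChain, e]; exact h, e⟩

theorem IsChain.eq [Finite V] {x y : V} (hx : Y.IsChain x) (hy : Y.IsChain y)
    (h : Y.block x = Y.block y) : x = y := by
  rw [IsChain, h] at hx
  exact IsFirst.eq hx hy

/-- Points that are neighbours in the order of two arms are in consecutive blocks of one turn, or
the deeper one is first in its block. -/
theorem block_of_consecutive [Finite V] {i : ℕ} {x y : V}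
    (hx : Y.arm x % 4 = i % 4 ∨ Y.arm x % 4 = (i + 1) % 4)
    (hy : Y.arm y % 4 = i % 4 ∨ Y.arm y % 4 = (i + 1) % 4) (hxy : Y.key i x < Y.key i y)
    (hcons : ∀ w, (Y.arm w % 4 = i % 4 ∨ Y.arm w % 4 = (i + 1) % 4) → Y.key i x < Y.key i w →
      Y.key i y ≤ Y.key i w) :
    (∃ j, j % 4 = i % 4 ∧ (Y.block x = j ∨ Y.block x = j + 1) ∧
      (Y.block y = j ∨ Y.block y = j + 1)) ∨
    (Y.IsChain y ∧ Y.block x < Y.block y ∧ Y.block y ≤ Y.block x + 4) := by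
  have px := Y.block_pos x
  have py := Y.block_pos y
  rw [Y.arm_mod] at hx hy
  by_cases hturn : ∃ j, j % 4 = i % 4 ∧ (Y.block x = j ∨ Y.block x = j + 1) ∧
      (Y.block y = j ∨ Y.block y = j + 1)
  · exact Or.inl hturn
  right
  obtain ⟨p, hp, hxp⟩ : ∃ p, p % 4 = i % 4 ∧ (Y.block x = p ∨ Y.block x = p + 1) := by
    rcases hx with h | h
    · exact ⟨Y.block x, h, Or.inl rfl⟩
    · exact ⟨Y.block x - 1, by omega, by omega⟩
  obtain ⟨q, hq, hyq⟩ : ∃ q, q % 4 = i % 4 ∧ (Y.block y = q ∨ Y.block y = q + 1) := by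
    rcases hy with h | h
    · exact ⟨Y.block y, h, Or.inl rfl⟩
    · exact ⟨Y.block y - 1, by omega, by omega⟩
  have hpq : p < q := by
    by_contra hle
    have hne : p ≠ q := by rintro rfl; exact hturn ⟨p, hp, hxp, hyq⟩
    have := Y.key_lt_of_block_lt (by omega : q < p) (by omega) hyq hxp
    rw [Y.key_congr (by omega : q % 4 = i % 4), Y.key_congr (by omega : q % 4 = i % 4)] at this
    omega
  -- A point of a later turn than that of `x` is deeper than `x`, hence not above `y`, the next
  -- point.
  have hkey : ∀ w, (Y.arm w % 4 = q % 4 ∨ Y.arm w % 4 = (q + 1) % 4) → p < Y.block w →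
      ¬ Y.block w = p + 1 → Y.key q y ≤ Y.key q w := by
    intro w hw hpw hpw'
    have aw := Y.arm_mod w
    rw [Y.key_congr (by omega : q % 4 = i % 4), Y.key_congr (by omega : q % 4 = i % 4)]
    refine hcons w (by omega) ?_
    have := Y.key_lt_of_block_lt (x := x) (y := w) (i := p)
      (j := if Y.block w % 4 = p % 4 then Y.block w else Y.block w - 1)
      (by split_ifs <;> omega) (by split_ifs <;> omega) hxp (by split_ifs <;> omega)
    rwa [Y.key_congr (by omega : p % 4 = i % 4), Y.key_congr (by omega : p % 4 = i % 4)] at this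
  have hq4 : 4 ≤ q := by omega
  -- In the second block of its turn, `y` would be preceded by a point of `upper q`, which would lie
  -- between `x` and `y`.
  have hyq' : Y.block y = q := by
    rcases hyq with h | h
    · exact h
    exfalso
    obtain ⟨w, hw, hwy⟩ := Y.exists_of_mem_upper_succ hq4
      ((Y.mem_upper_iff (z := y) (i := q + 1)).2 (by omega))
    have h1 := Y.mem_upper_iff.1 hw
    have h2 := hkey w (Or.inl (Y.arm_of_mem_upper hw)) (by omega) (by omega)
    omega
  have hfirst : Y.IsFirst q y := by
    refine ⟨Y.mem_upper_iff.2 (by omega), fun w hw => ?_⟩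
    have h1 := Y.mem_upper_iff.1 hw
    exact hkey w (Or.inl (Y.arm_of_mem_upper hw)) (by omega) (by omega)
  refine ⟨by rw [IsChain, hyq']; exact hfirst, by omega, ?_⟩
  -- Otherwise the first point of `upper (q - 4)` is already deeper than `x`, and minimality on both
  -- sides identifies it with `y`, although their blocks differ.
  by_contra hfar
  have hmem : y ∈ Y.upper (q - 4) := Y.mem_upper_iff.2 (by omega)
  obtain ⟨w, hw⟩ := Y.exists_isFirst ⟨y, hmem⟩
  have hwb := (Y.isChain_of_isFirst (by omega) hw).2
  have h1 := hkey w (by rw [Y.arm_mod]; omega) (by omega) (by omega)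
  have h2 := hw.2 y hmem
  rw [Y.key_congr (by omega : (q - 4) % 4 = q % 4),
    Y.key_congr (by omega : (q - 4) % 4 = q % 4)] at h2
  have h3 := Y.key_inj q y w (by rw [Y.arm_mod]; omega) (by rw [Y.arm_mod]; omega) (by omega)
  subst h3
  omega

end SpiralSystem

end PermPattern

namespace PermPattern

/-! ### A common linear extension of the orders of consecutive blocks -/

/-- A relation on a finite set such that every nonempty subset has a minimal element has a linear
extension. -/
theorem exists_linear_extension {V : Type*} [Fintype V] (r : V → V → Prop)
    (hmin : ∀ W : Finset V, W.Nonempty → ∃ z ∈ W, ∀ w ∈ W, ¬ r w z) :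
    ∃ τ : V → ℕ, Function.Injective τ ∧ ∀ x y, r x y → τ x < τ y := by
  classical
  have aux : ∀ n (W : Finset V), W.card = n →
      ∃ τ : V → ℕ, Set.InjOn τ W ∧ ∀ x ∈ W, ∀ y ∈ W, r x y → τ x < τ y := by
    intro n
    induction n with
    | zero =>
      intro W hW
      rw [Finset.card_eq_zero] at hW
      subst hW
      exact ⟨fun _ => 0, by simp, by simp⟩
    | succ n ih =>
      intro W hW
      obtain ⟨z, hz, hzmin⟩ := hmin W (Finset.card_pos.1 (by omega))
      obtain ⟨τ, hinj, hτ⟩ := ih (W.erase z) (by rw [Finset.card_erase_of_mem hz, hW]; rfl)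
      refine ⟨fun x => if x = z then 0 else τ x + 1, ?_, ?_⟩
      · intro x hx y hy hxy
        by_cases h1 : x = z <;> by_cases h2 : y = z <;> simp only [h1, h2, if_true, if_false] at hxy
        · rw [h1, h2]
        · omega
        · omega
        · exact hinj (by simpa [h1] using hx) (by simpa [h2] using hy) (by omega)
      · intro x hx y hy hxy
        have h2 : y ≠ z := by
          rintro rfl
          exact hzmin x hx hxy
        by_cases h1 : x = z
        · simp [h1, h2]
        · have := hτ x (by simp [h1, hx]) y (by simp [h2, hy]) hxy
          simp [h1, h2, this]
  obtain ⟨τ, hinj, hτ⟩ := aux _ Finset.univ rfl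
  exact ⟨τ, fun x y h => hinj (by simp) (by simp) h, fun x y => hτ x (by simp) y (by simp)⟩

namespace SpiralSystem

variable {V : Type*} (Y : SpiralSystem V)

/-- The order of points in consecutive blocks. -/
def Before [Finite V] (x y : V) : Prop :=
  ∃ i, (Y.block x = i ∨ Y.block x = i + 1) ∧ (Y.block y = i ∨ Y.block y = i + 1) ∧
    Y.key i x < Y.key i y

/-- Inside one block the two keys that apply to it give the same order. -/
theorem before_of_block_eq [Finite V] {i : ℕ} {x y : V} (hxy : Y.block x = Y.block y)
    (hi : Y.block x = i ∨ Y.block x = i + 1) (h : Y.Before x y) : Y.key i x < Y.key i y := by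
  have ax := Y.arm_mod x
  have ay := Y.arm_mod y
  obtain ⟨j, hj, -, hlt⟩ := h
  rcases lt_trichotomy i j with hij | rfl | hij
  · have e : j = i + 1 := by omega
    subst e
    exact (Y.key_succ i x y (by omega) (by omega)).2 hlt
  · exact hlt
  · have e : i = j + 1 := by omega
    subst e
    exact (Y.key_succ j x y (by omega) (by omega)).1 hlt

/-- This excludes cycles of `Before`: the blocks form a path, so it suffices to move from block to
block in one direction until no obstruction remains. -/
theorem exists_minimal_before [Finite V] (W : Finset V) (hW : W.Nonempty) :
    ∃ z ∈ W, ∀ w ∈ W, ¬ Y.Before w z := by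
  classical
  have first : ∀ b, (∃ z ∈ W, Y.block z = b) → ∃ z ∈ W, Y.block z = b ∧
      ∀ w ∈ W, Y.block w = b → Y.key b z ≤ Y.key b w := by
    rintro b ⟨z, hz, hzb⟩
    obtain ⟨y, hy, hmin⟩ := Finset.exists_min_image (W.filter (Y.block · = b)) (Y.key b)
      ⟨z, by simp [hz, hzb]⟩
    simp only [Finset.mem_filter] at hy hmin
    exact ⟨y, hy.1, hy.2, fun w hw hwb => hmin w ⟨hw, hwb⟩⟩
  -- Candidates are unobstructed from their own and the previous block; the candidate in the last
  -- possible block is also unobstructed from the next.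
  let Q := W.filter fun z => (∀ w ∈ W, Y.block w = Y.block z → Y.key (Y.block z) z ≤
    Y.key (Y.block z) w) ∧ ∀ w ∈ W, Y.block z = Y.block w + 1 → ¬ Y.Before w z
  have hQ : Q.Nonempty := by
    obtain ⟨y, hy, hmin⟩ := Finset.exists_min_image W Y.block hW
    obtain ⟨z, hz, hzb, hzmin⟩ := first _ ⟨y, hy, rfl⟩
    refine ⟨z, ?_⟩
    simp only [Q, Finset.mem_filter, hzb]
    refine ⟨hz, hzmin, fun w hw hwz => ?_⟩
    have := hmin w hw
    omega
  obtain ⟨z, hz, hmax⟩ := Finset.exists_max_image Q Y.block hQ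
  simp only [Q, Finset.mem_filter] at hz hmax
  obtain ⟨hzW, hz1, hz2⟩ := hz
  refine ⟨z, hzW, fun w hw hwz => ?_⟩
  have hnear : Y.block w = Y.block z ∨ Y.block z = Y.block w + 1 ∨
      Y.block w = Y.block z + 1 := by
    obtain ⟨i, h1, h2, -⟩ := hwz
    omega
  rcases hnear with h | h | h
  · have := Y.before_of_block_eq h (Or.inl h) hwz
    have := hz1 w hw h
    omega
  · exact hz2 w hw h hwz
  · obtain ⟨y, hy, hyb, hymin⟩ := first _ ⟨w, hw, rfl⟩
    have ay := Y.arm_mod y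
    have aw := Y.arm_mod w
    have az := Y.arm_mod z
    have hwz' : Y.key (Y.block z) w < Y.key (Y.block z) z := by
      obtain ⟨i, h1, h2, h3⟩ := hwz
      have : i = Y.block z := by omega
      rwa [← this]
    have hyw : Y.key (Y.block z) y ≤ Y.key (Y.block z) w := by
      by_contra hlt
      have := (Y.key_succ (Y.block z) w y (by omega) (by omega)).1 (by omega)
      have h4 := hymin w hw rfl
      rw [h] at h4
      omega
    -- The first point `y` of the obstructing block precedes `z`, which is first in its own block;
    -- so nothing there precedes `y`, and `y` is a candidate further on.
    have hyQ := hmax y ⟨hy, by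
      rw [hyb]
      exact hymin, by
      rintro v hv hvy ⟨i, h1, h2, h3⟩
      have hi : i = Y.block v := by omega
      have hvz : Y.block v = Y.block z := by omega
      rw [hi, hvz] at h3
      have := hz1 v hv hvz
      omega⟩
    omega

theorem exists_time [Fintype V] : ∃ τ : V → ℕ, Function.Injective τ ∧
    ∀ i x y, (Y.block x = i ∨ Y.block x = i + 1) → (Y.block y = i ∨ Y.block y = i + 1) →
      (Y.key i x < Y.key i y ↔ τ x < τ y) := by
  obtain ⟨τ, hinj, hτ⟩ := exists_linear_extension Y.Before Y.exists_minimal_before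
  refine ⟨τ, hinj, fun i x y hx hy => ⟨fun h => hτ x y ⟨i, hx, hy, h⟩, fun h => ?_⟩⟩
  by_contra hle
  have ax := Y.arm_mod x
  have ay := Y.arm_mod y
  rcases lt_or_eq_of_le (not_lt.1 hle) with h1 | h1
  · have := hτ y x ⟨i, hy, hx, h1⟩
    omega
  · have := Y.key_inj i y x (by omega) (by omega) h1
    subst this
    omega

end SpiralSystem

end PermPattern

namespace PermPattern

/-! ### Waves, routes and separations in a strip

A strip consists of points with a block index `β` and a time `τ`; points of the blocks `i` and
`i + 1` are ordered by time. -/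

section Strip

variable {V : Type*} {β τ : V → ℕ}

/-- The points of block `t` that are above `h` successive waves. -/
def wave (β τ : V → ℕ) : ℕ → ℕ → Set V
  | 0, t => {y | β y = t}
  | h + 1, t => {y | β y = t ∧ (∃ x ∈ wave β τ h (t - 1), τ x < τ y) ∧
      ∃ x ∈ wave β τ h (t + 1), τ x < τ y}

theorem block_of_mem_wave {h t : ℕ} {y : V} (hy : y ∈ wave β τ h t) : β y = t := by
  cases h with
  | zero => exact hy
  | succ h => exact hy.1

theorem wave_succ_subset (h t : ℕ) : wave β τ (h + 1) t ⊆ wave β τ h t := by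
  induction h generalizing t with
  | zero => exact fun y hy => hy.1
  | succ h ih =>
    rintro y ⟨h1, ⟨x, hx, hxy⟩, x', hx', hxy'⟩
    exact ⟨h1, ⟨x, ih _ hx, hxy⟩, x', ih _ hx', hxy'⟩

theorem wave_antitone {h h' : ℕ} (hh : h ≤ h') (t : ℕ) : wave β τ h' t ⊆ wave β τ h t := by
  induction h', hh using Nat.le_induction with
  | base => exact subset_rfl
  | succ n _ ih => exact (wave_succ_subset n t).trans ih

/-- The first point of a wave. -/
def IsWaveMin (β τ : V → ℕ) (h t : ℕ) (y : V) : Prop :=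
  y ∈ wave β τ h t ∧ ∀ z ∈ wave β τ h t, τ y ≤ τ z

theorem exists_isWaveMin [Finite V] {h t : ℕ} (hne : (wave β τ h t).Nonempty) :
    ∃ y, IsWaveMin β τ h t y := by
  obtain ⟨y, hy, hmin⟩ := Set.exists_min_image _ τ (Set.toFinite _) hne
  exact ⟨y, hy, hmin⟩

/-- A zigzag route upwards through the strip: `r 0` is the first point of its block, each `r (l + 1)`
is the first point after `r l` in a block next to that of `r l`, and there is no point of block
`b (H + 1)` after `r H`. -/
structure IsRoute (β τ : V → ℕ) (H : ℕ) (r : ℕ → V) (b : ℕ → ℕ) : Prop where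
  block : ∀ l ≤ H, β (r l) = b l
  step : ∀ l ≤ H, b (l + 1) = b l + 1 ∨ b l = b (l + 1) + 1
  lt : ∀ l < H, τ (r l) < τ (r (l + 1))
  next : ∀ l < H, ∀ z, β z = b (l + 1) → τ (r l) < τ z → τ (r (l + 1)) ≤ τ z
  last : ∀ z, β z = b (H + 1) → ¬ τ (r H) < τ z
  first : ∀ z, β z = b 0 → τ (r 0) ≤ τ z

/-- An initial segment of a route. -/
structure IsPartialRoute (β τ : V → ℕ) (H : ℕ) (r : ℕ → V) (b : ℕ → ℕ) : Prop where
  block : ∀ l ≤ H, β (r l) = b l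
  step : ∀ l < H, b (l + 1) = b l + 1 ∨ b l = b (l + 1) + 1
  lt : ∀ l < H, τ (r l) < τ (r (l + 1))
  next : ∀ l < H, ∀ z, β z = b (l + 1) → τ (r l) < τ z → τ (r (l + 1)) ≤ τ z
  first : ∀ z, β z = b 0 → τ (r 0) ≤ τ z

/-- The route is traced backwards from the first point of a wave, one wave lower at each step; `h ≤
t` keeps `t - 1` from being truncated. -/
theorem exists_isPartialRoute [Finite V] (h t : ℕ) (ht : h ≤ t) {y : V}
    (hy : IsWaveMin β τ h t y) :
    ∃ r b, IsPartialRoute β τ h r b ∧ r h = y ∧ b h = t := by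
  induction h generalizing t y with
  | zero =>
    refine ⟨fun _ => y, fun _ => t, ⟨?_, ?_, ?_, ?_, ?_⟩, rfl, rfl⟩
    · exact fun l _ => block_of_mem_wave hy.1
    · intro l hl
      omega
    · intro l hl
      omega
    · intro l hl
      omega
    · exact fun z hz => hy.2 z hz
  | succ h ih =>
    have hyt := block_of_mem_wave hy.1
    obtain ⟨-, ⟨x₁, hx₁, hxy₁⟩, x₂, hx₂, hxy₂⟩ := hy.1
    obtain ⟨m₁, hm₁⟩ := exists_isWaveMin ⟨x₁, hx₁⟩
    obtain ⟨m₂, hm₂⟩ := exists_isWaveMin ⟨x₂, hx₂⟩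
    have l₁ : τ m₁ < τ y := (hm₁.2 _ hx₁).trans_lt hxy₁
    have l₂ : τ m₂ < τ y := (hm₂.2 _ hx₂).trans_lt hxy₂
    -- Take the later of the two first points: every point of block `t` after it is above both,
    -- hence in the next wave, so `y` is the first such point.
    obtain ⟨m, t', ht', hm, hmy, hle, htt⟩ : ∃ m t', h ≤ t' ∧ IsWaveMin β τ h t' m ∧
        τ m < τ y ∧ (τ m₁ ≤ τ m ∧ τ m₂ ≤ τ m) ∧ (t = t' + 1 ∨ t' = t + 1) := by
      rcases le_total (τ m₁) (τ m₂) with h12 | h12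
      · exact ⟨m₂, t + 1, by omega, hm₂, l₂, ⟨h12, le_rfl⟩, Or.inr rfl⟩
      · exact ⟨m₁, t - 1, by omega, hm₁, l₁, ⟨le_rfl, h12⟩, Or.inl (by omega)⟩
    obtain ⟨r, b, hrb, hrm, hbt⟩ := ih t' ht' hm
    refine ⟨fun l => if l ≤ h then r l else y, fun l => if l ≤ h then b l else t,
      ⟨?_, ?_, ?_, ?_, ?_⟩, by simp, by simp⟩
    · intro l _
      by_cases hl : l ≤ h
      · simp only [hl, if_true]; exact hrb.block l hl
      · simp only [hl, if_false]; exact hyt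
    · intro l hl
      by_cases hl' : l + 1 ≤ h
      · simp only [hl', show l ≤ h by omega, if_true]; exact hrb.step l hl'
      · have e : l = h := by omega
        subst e
        simp only [hl', le_refl, if_true, if_false]
        omega
    · intro l hl
      by_cases hl' : l + 1 ≤ h
      · simp only [hl', show l ≤ h by omega, if_true]; exact hrb.lt l hl'
      · have e : l = h := by omega
        subst e
        simp only [hl', le_refl, if_true, if_false, hrm]
        exact hmy
    · intro l hl z
      by_cases hl' : l + 1 ≤ h
      · simp only [hl', show l ≤ h by omega, if_true]; exact hrb.next l hl' z
      · have e : l = h := by omega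
        subst e
        simp only [hl', le_refl, if_true, if_false, hrm]
        intro hz hmz
        exact hy.2 z ⟨hz, ⟨m₁, hm₁.1, hle.1.trans_lt hmz⟩, m₂, hm₂.1, hle.2.trans_lt hmz⟩
    · intro z
      simp only [Nat.zero_le, if_true]
      exact hrb.first z

/-- After the later of the two neighbouring first points, a point of block `t` would belong to the
empty wave; so the route ending there has reached the top. -/
theorem exists_isRoute [Finite V] {h t : ℕ} (ht : h < t) (hempty : wave β τ (h + 1) t = ∅)
    (h₁ : (wave β τ h (t - 1)).Nonempty) (h₂ : (wave β τ h (t + 1)).Nonempty) :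
    ∃ r b, IsRoute β τ h r b ∧ b (h + 1) = t := by
  obtain ⟨m₁, hm₁⟩ := exists_isWaveMin h₁
  obtain ⟨m₂, hm₂⟩ := exists_isWaveMin h₂
  obtain ⟨m, t', ht', hm, hle, htt⟩ : ∃ m t', h ≤ t' ∧ IsWaveMin β τ h t' m ∧
      (τ m₁ ≤ τ m ∧ τ m₂ ≤ τ m) ∧ (t = t' + 1 ∨ t' = t + 1) := by
    rcases le_total (τ m₁) (τ m₂) with h12 | h12
    · exact ⟨m₂, t + 1, by omega, hm₂, ⟨h12, le_rfl⟩, Or.inr rfl⟩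
    · exact ⟨m₁, t - 1, by omega, hm₁, ⟨le_rfl, h12⟩, Or.inl (by omega)⟩
  obtain ⟨r, b, hrb, hrm, hbt⟩ := exists_isPartialRoute h t' ht' hm
  refine ⟨r, fun l => if l ≤ h then b l else t, ⟨?_, ?_, ?_, ?_, ?_, ?_⟩, by simp⟩
  · intro l hl
    simp only [hl, if_true]
    exact hrb.block l hl
  · intro l hl
    by_cases hl' : l + 1 ≤ h
    · simp only [hl', show l ≤ h by omega, if_true]; exact hrb.step l hl'
    · have e : l = h := by omega
      subst e
      simp only [hl', le_refl, if_true, if_false]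
      omega
  · exact hrb.lt
  · intro l hl z
    simp only [show l + 1 ≤ h by omega, if_true]
    exact hrb.next l hl z
  · intro z hz hmz
    rw [hrm] at hmz
    simp only [show ¬ h + 1 ≤ h by omega, if_false] at hz
    have : z ∈ wave β τ (h + 1) t :=
      ⟨hz, ⟨m₁, hm₁.1, hle.1.trans_lt hmz⟩, m₂, hm₂.1, hle.2.trans_lt hmz⟩
    rw [hempty] at this
    exact this
  · intro z
    simp only [Nat.zero_le, if_true]
    exact hrb.first z

/-- `x` and `y` belong to the blocks `t` and `t + 1` `x` is before `y` and no point of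
these blocks is strictly between them. -/
def Consecutive (β τ : V → ℕ) (t : ℕ) (x y : V) : Prop :=
  (β x = t ∨ β x = t + 1) ∧ (β y = t ∨ β y = t + 1) ∧ τ x < τ y ∧
    ∀ w, (β w = t ∨ β w = t + 1) → τ x < τ w → τ y ≤ τ w

namespace IsRoute

variable {H : ℕ} {r : ℕ → V} {b : ℕ → ℕ}

/-- The last point of the route that is not later than `z` (or the first point). -/
def pos (τ : V → ℕ) (H : ℕ) (r : ℕ → V) (z : V) : ℕ :=
  Nat.findGreatest (fun l => τ (r l) ≤ τ z) H

/-- The points to the left of the route. -/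
def left (β τ : V → ℕ) (H : ℕ) (r : ℕ → V) (b : ℕ → ℕ) : Set V :=
  {z | 2 * β z < b (pos τ H r z) + b (pos τ H r z + 1)}

theorem time_mono (h : IsRoute β τ H r b) {l l' : ℕ} (hl : l ≤ l') (hl' : l' ≤ H) :
    τ (r l) ≤ τ (r l') := by
  induction l', hl using Nat.le_induction with
  | base => exact le_rfl
  | succ n _ ih => exact (ih (by omega)).trans (h.lt n (by omega)).le

/-- A consecutive pair can change sides only if its later point is on the route, which is why
nothing is asked of `x`. -/
theorem mem_left_iff (h : IsRoute β τ H r b) (hτ : Function.Injective τ) {t : ℕ} {x y : V}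
    (hxy : Consecutive β τ t x y) (hy : ∀ l ≤ H, r l ≠ y) :
    x ∈ left β τ H r b ↔ y ∈ left β τ H r b := by
  obtain ⟨hx1, hy1, hlt, hcons⟩ := hxy
  have hmono : pos τ H r x ≤ pos τ H r y := by
    apply Nat.findGreatest_mono_left
    intro l hl
    exact le_trans hl hlt.le
  have hxH : pos τ H r x ≤ H := Nat.findGreatest_le H
  have hyH : pos τ H r y ≤ H := Nat.findGreatest_le H
  have gx : ∀ l, pos τ H r x < l → l ≤ H → τ x < τ (r l) := fun l h1 h2 =>
    not_le.1 (Nat.findGreatest_is_greatest (P := fun l => τ (r l) ≤ τ x) h1 h2)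
  have gy : ∀ l, pos τ H r y < l → l ≤ H → τ y < τ (r l) := fun l h1 h2 =>
    not_le.1 (Nat.findGreatest_is_greatest (P := fun l => τ (r l) ≤ τ y) h1 h2)
  have sx : pos τ H r x ≠ 0 → τ (r (pos τ H r x)) ≤ τ x := fun h1 =>
    Nat.findGreatest_of_ne_zero (P := fun l => τ (r l) ≤ τ x) rfl h1
  have sy : pos τ H r y ≠ 0 → τ (r (pos τ H r y)) ≤ τ y := fun h1 =>
    Nat.findGreatest_of_ne_zero (P := fun l => τ (r l) ≤ τ y) rfl h1
  have hbetween : ∀ l ≤ H, τ x < τ (r l) → τ (r l) ≤ τ y → b l ≠ t ∧ b l ≠ t + 1 := by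
    intro l hl h1 h2
    by_contra hcon
    have h3 := hcons (r l) (by rw [h.block l hl]; omega) h1
    exact hy l hl (hτ (le_antisymm h2 h3))
  change 2 * β x < b (pos τ H r x) + b (pos τ H r x + 1) ↔
    2 * β y < b (pos τ H r y) + b (pos τ H r y + 1)
  generalize pos τ H r x = p at *
  generalize pos τ H r y = q at *
  rcases hmono.eq_or_lt with rfl | hpq
  -- Same route position: on different sides, `x` and `y` would occupy the blocks `b p` and `b (p +
  -- 1)`, and by greediness the route would have a point after `x` and up to `y`, or no point could
  -- follow its end.
  · have hstep := h.step p hxH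
    by_contra hcon
    obtain ⟨u, w, hu, hw, hux, hwx⟩ : ∃ u w, β u = b p ∧ β w = b (p + 1) ∧
        (u = x ∨ u = y) ∧ (w = x ∨ w = y) := by
      rcases hstep with hs | hs
      · rcases hx1 with hx1 | hx1
        · exact ⟨x, y, by omega, by omega, Or.inl rfl, Or.inr rfl⟩
        · exact ⟨y, x, by omega, by omega, Or.inr rfl, Or.inl rfl⟩
      · rcases hx1 with hx1 | hx1
        · exact ⟨y, x, by omega, by omega, Or.inr rfl, Or.inl rfl⟩
        · exact ⟨x, y, by omega, by omega, Or.inl rfl, Or.inr rfl⟩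
    have hwy : τ x ≤ τ w ∧ τ w ≤ τ y := by rcases hwx with rfl | rfl <;> omega
    have huy : τ u ≤ τ y := by rcases hux with rfl | rfl <;> omega
    have hb : b p = t ∨ b p = t + 1 := by rcases hux with rfl | rfl <;> omega
    by_cases hle : τ (r p) ≤ τ x
    · by_cases hne : τ (r p) < τ w
      · rcases hxH.eq_or_lt with e | e
        · rw [e] at hne hw
          exact h.last w hw hne
        · have := h.next p e w hw hne
          have := gy (p + 1) (by omega) e
          omega
      · have e := hτ (le_antisymm (hle.trans hwy.1) (not_lt.1 hne))
        rw [← e, h.block p hxH] at hw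
        omega
    · have hp0 : p = 0 := by
        by_contra h0
        exact hle (sx h0)
      subst hp0
      have h1 := h.first u hu
      exact absurd hb (by have := hbetween 0 (by omega) (by omega) (by omega); omega)
  -- The route points met between `x` and `y` avoid the blocks `t` and `t + 1`; moving by single
  -- blocks, they stay on one side of both.
  · have hside : (∀ l, p < l → l ≤ q → t + 2 ≤ b l) ∨ (∀ l, p < l → l ≤ q → b l < t) := by
      have hne : ∀ l, p < l → l ≤ q → b l ≠ t ∧ b l ≠ t + 1 := fun l h1 h2 =>
        hbetween l (h2.trans hyH) (gx l h1 (h2.trans hyH))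
          ((h.time_mono h2 hyH).trans (sy (by omega)))
      rcases lt_or_ge (b (p + 1)) t with h1 | h1
      · right
        intro l hl
        induction l, hl using Nat.le_induction with
        | base => exact fun _ => h1
        | succ l hl ih =>
          intro hlq
          have h2 := ih (by omega)
          have h3 := hne (l + 1) (by omega) hlq
          have h4 := h.step l (by omega)
          omega
      · left
        intro l hl
        induction l, hl using Nat.le_induction with
        | base =>
          intro hlq
          have := hne (p + 1) (by omega) hlq
          change t + 2 ≤ b (p + 1)
          omega
        | succ l hl ih =>
          intro hlq
          have h2 := ih (by omega)
          have h3 := hne (l + 1) (by omega) hlq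
          have h4 := h.step l (by omega)
          omega
    have h1 := h.step p hxH
    have h2 := h.step q hyH
    rcases hside with hs | hs
    · have h3 := hs (p + 1) (by omega) hpq
      have h4 := hs q hpq le_rfl
      omega
    · have h3 := hs (p + 1) (by omega) hpq
      have h4 := hs q hpq le_rfl
      omega

theorem block_bounds (h : IsRoute β τ H r b) {l : ℕ} (hl : l ≤ H + 1) :
    b (H + 1) ≤ b l + (H + 1) ∧ b l ≤ b (H + 1) + (H + 1) := by
  have aux : ∀ d, d ≤ H + 1 →
      b (H + 1) ≤ b (H + 1 - d) + d ∧ b (H + 1 - d) ≤ b (H + 1) + d := by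
    intro d
    induction d with
    | zero => intro _; simp
    | succ d ih =>
      intro hd
      have h1 := ih (by omega)
      have h2 := h.step (H + 1 - (d + 1)) (by omega)
      rw [show H + 1 - (d + 1) + 1 = H + 1 - d by omega] at h2
      omega
  have := aux (H + 1 - l) (by omega)
  rw [show H + 1 - (H + 1 - l) = l by omega] at this
  omega

end IsRoute

end Strip

end PermPattern

namespace PermPattern

/-! ### Walls force long waves -/

/-- Apart from a set `Z` of at most two vertices, the edges of `G` join consecutive points of the
strip, or one of their ends belongs to a set `chain` with at most one point in each block and the
other end is at most four blocks away. -/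
structure IsStripGraph {V : Type*} (G : SimpleGraph V) (β τ : V → ℕ) (chain : Set V)
    (Z : Finset V) : Prop where
  time_injective : Function.Injective τ
  card_le : Z.card ≤ 2
  chain_inj : ∀ x ∈ chain, ∀ y ∈ chain, β x = β y → x = y
  adj : ∀ x y, x ∉ Z → y ∉ Z → G.Adj x y →
    (∃ t, Consecutive β τ t x y ∨ Consecutive β τ t y x) ∨
    ((x ∈ chain ∨ y ∈ chain) ∧ β x ≤ β y + 4 ∧ β y ≤ β x + 4)

namespace IsStripGraph

variable {V : Type*} [Fintype V] {G : SimpleGraph V} {β τ : V → ℕ} {chain : Set V} {Z : Finset V}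

theorem exists_chain_window (h : IsStripGraph G β τ chain Z) (lo hi : ℕ) :
    ∃ A : Finset V, A.card ≤ hi + 1 - lo ∧ ∀ x ∈ chain, lo ≤ β x → β x ≤ hi → x ∈ A := by
  classical
  refine ⟨Finset.univ.filter fun x => x ∈ chain ∧ lo ≤ β x ∧ β x ≤ hi, ?_, ?_⟩
  · rw [← Nat.card_Icc]
    refine Finset.card_le_card_of_injOn β ?_ ?_
    · intro x hx
      have hx := (Finset.mem_filter.1 (Finset.mem_coe.1 hx)).2
      simpa using hx.2
    · intro x hx y hy hxy
      have hx := (Finset.mem_filter.1 (Finset.mem_coe.1 hx)).2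
      have hy := (Finset.mem_filter.1 (Finset.mem_coe.1 hy)).2
      exact h.chain_inj x hx.1 y hy.1 hxy
  · intro x hx h1 h2
    simp [hx, h1, h2]

theorem exists_separates (h : IsStripGraph G β τ chain Z) {S : Set V} {A : Finset V} {lo hi : ℕ}
    (hle : lo ≤ hi)
    (hA : ∀ t x y, Consecutive β τ t x y → x ∉ A → y ∉ A → (x ∈ S ↔ y ∈ S))
    (hlo : ∀ z, β z < lo → z ∈ S) (hhi : ∀ z ∈ S, β z ≤ hi) :
    ∃ X : Finset V, X.card ≤ A.card + (hi - lo) + 11 ∧ Separates G X S := by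
  classical
  -- Chain edges span at most four blocks, so a margin of four suffices. It adds at most `hi - lo +
  -- 9` vertices, and `Z` adds two.
  obtain ⟨B, hBcard, hB⟩ := h.exists_chain_window (lo - 4) (hi + 4)
  refine ⟨A ∪ B ∪ Z, ?_, ?_⟩
  · have h1 := Finset.card_union_le (A ∪ B) Z
    have h2 := Finset.card_union_le A B
    have h3 := h.card_le
    omega
  · intro x y hx hy hxy hxS
    simp only [Finset.mem_union, not_or] at hx hy
    rcases h.adj x y hx.2 hy.2 hxy with ⟨t, ht | ht⟩ | ⟨hch, h1, h2⟩
    · exact (hA t x y ht hx.1.1 hy.1.1).1 hxS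
    · exact (hA t y x ht hy.1.1 hx.1.1).2 hxS
    · have hxhi := hhi x hxS
      rcases hch with hch | hch
      · have h3 := mt (hB x hch · (by omega)) hx.1.2
        exact hlo y (by omega)
      · have h3 := mt (hB y hch · (by omega)) hy.1.2
        exact hlo y (by omega)

/-- Either a lower wave already misses a neighbouring block, or an emptiness that starts exactly
here produces a route to cut along. -/
theorem exists_separates_of_wave_eq_empty (h : IsStripGraph G β τ chain Z) (k t : ℕ) (hkt : k < t)
    (hk : wave β τ k t = ∅) :
    ∃ (X : Finset V) (S : Set V), X.card ≤ 3 * k + 11 ∧ Separates G X S ∧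
      (∀ z, β z + k < t → z ∈ S) ∧ ∀ z ∈ S, β z ≤ t + k := by
  classical
  induction k generalizing t with
  | zero =>
    have hB : ∀ z, β z ≠ t := fun z hz => by
      have : z ∈ wave β τ 0 t := hz
      rw [hk] at this
      exact this
    obtain ⟨X, hX, hS⟩ := h.exists_separates (S := {z | β z < t}) (A := ∅) (lo := t) (hi := t)
      le_rfl (by
        rintro u x y ⟨hx, hy, -⟩ - -
        have h1 := hB x
        have h2 := hB y
        simp only [Set.mem_ofPred_eq]
        omega) (fun z hz => hz) (fun z hz => le_of_lt hz)
    exact ⟨X, _, by simpa using hX, hS, fun z hz => hz, fun z hz => le_of_lt hz⟩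
  | succ k ih =>
    rcases Set.eq_empty_or_nonempty (wave β τ k (t - 1)) with h1 | h1
    · obtain ⟨X, S, hX, hS, hlo, hhi⟩ := ih (t - 1) (by omega) h1
      refine ⟨X, S, by omega, hS, fun z hz => hlo z (by omega), fun z hz => ?_⟩
      have := hhi z hz
      omega
    rcases Set.eq_empty_or_nonempty (wave β τ k (t + 1)) with h2 | h2
    · obtain ⟨X, S, hX, hS, hlo, hhi⟩ := ih (t + 1) (by omega) h2
      refine ⟨X, S, by omega, hS, fun z hz => hlo z (by omega), fun z hz => ?_⟩
      have := hhi z hz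
      omega
    obtain ⟨r, b, hr, hb⟩ := exists_isRoute (by omega) hk h1 h2
    have hbd : ∀ z, t ≤ b (IsRoute.pos τ k r z) + (k + 1) ∧ b (IsRoute.pos τ k r z) ≤ t + (k + 1) ∧
        t ≤ b (IsRoute.pos τ k r z + 1) + (k + 1) ∧
        b (IsRoute.pos τ k r z + 1) ≤ t + (k + 1) := by
      intro z
      have hp : IsRoute.pos τ k r z ≤ k := Nat.findGreatest_le k
      have e1 := hr.block_bounds (l := IsRoute.pos τ k r z) (by omega)
      have e2 := hr.block_bounds (l := IsRoute.pos τ k r z + 1) (by omega)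
      omega
    have hlo : ∀ z, β z + (k + 1) < t → z ∈ IsRoute.left β τ k r b := by
      intro z hz
      have := hbd z
      simp only [IsRoute.left, Set.mem_ofPred_eq]
      omega
    have hhi : ∀ z ∈ IsRoute.left β τ k r b, β z ≤ t + (k + 1) := by
      intro z hz
      have := hbd z
      simp only [IsRoute.left, Set.mem_ofPred_eq] at hz
      omega
    obtain ⟨X, hX, hS⟩ := h.exists_separates (S := IsRoute.left β τ k r b)
      (A := (Finset.range (k + 1)).image r) (lo := t - (k + 1)) (hi := t + (k + 1)) (by omega)
      (by
        intro u x y hxy _ hy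
        refine hr.mem_left_iff h.time_injective hxy fun l hl e => hy ?_
        exact Finset.mem_image.2 ⟨l, Finset.mem_range.2 (by omega), e⟩)
      (fun z hz => hlo z (by omega)) hhi
    refine ⟨X, _, ?_, hS, hlo, hhi⟩
    have := Finset.card_image_le (s := Finset.range (k + 1)) (f := r)
    rw [Finset.card_range] at this
    omega

/-- The last points before time `p` in pairs of consecutive blocks. -/
theorem exists_tops (h : IsStripGraph G β τ chain Z) (lo hi p : ℕ) :
    ∃ A : Finset V, A.card ≤ hi + 2 - lo ∧ ∀ t x y, Consecutive β τ t x y → lo ≤ β x → β x ≤ hi →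
      τ x < p → p ≤ τ y → x ∈ A := by
  classical
  -- The index `t` is the smaller block of a pair, so a point of block `lo` may come from `t = lo -
  -- 1`.
  refine ⟨(Finset.Icc (lo - 1) hi).biUnion fun t => Finset.univ.filter fun x =>
    (β x = t ∨ β x = t + 1) ∧ τ x < p ∧
      ∀ w, (β w = t ∨ β w = t + 1) → τ x < τ w → p ≤ τ w, ?_, ?_⟩
  · refine (Finset.card_biUnion_le_card_mul _ _ 1 ?_).trans ?_
    · intro t _
      rw [Finset.card_le_one]
      intro x hx y hy
      simp only [Finset.mem_filter, Finset.mem_univ, true_and] at hx hy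
      rcases lt_trichotomy (τ x) (τ y) with h1 | h1 | h1
      · have := hx.2.2 y hy.1 h1
        omega
      · exact h.time_injective h1
      · have := hy.2.2 x hx.1 h1
        omega
    · rw [Nat.card_Icc]
      omega
  · rintro t x y ⟨hx, hy, -, hcons⟩ h1 h2 h3 h4
    simp only [Finset.mem_biUnion, Finset.mem_Icc, Finset.mem_filter, Finset.mem_univ, true_and]
    exact ⟨t, by omega, hx, h3, fun w hw hxw => h4.trans (hcons w hw hxw)⟩

/-- Otherwise the rows would lie in `S'` outside `S`, a region few blocks wide. Every cut of it at a
fixed time is small, and a sweep in time cannot carry all rows across at once. -/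
theorem inside_of_inside (h : IsStripGraph G β τ chain Z) {m : ℕ} {R C : ℕ → Set V}
    (hm : IsMesh G m R C) {X X' : Finset V} {S S' : Set V} {lo hi : ℕ} (hX : Separates G X S)
    (hX' : Separates G X' S') (hlo : ∀ z ∈ S', z ∉ S → lo ≤ β z)
    (hhi : ∀ z ∈ S', z ∉ S → β z ≤ hi) (hle : lo ≤ hi)
    (hcard : 2 * (X.card + X'.card + 2 * (hi - lo) + 5) + 1 < m)
    (hin : IsMesh.Inside m R X' S') : IsMesh.Inside m R X S := by
  classical
  by_contra hout
  obtain ⟨B, hBcard, hB⟩ := h.exists_chain_window lo hi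
  choose A hAcard hA using h.exists_tops lo hi
  -- `D p` bounds the part `T p` of the region before time `p`: `X` and `X'` close its sides, `A p`
  -- its top, and `B` removes the chain edges.
  let D : ℕ → Finset V := fun p => X ∪ X' ∪ Z ∪ B ∪ A p
  let T : ℕ → Set V := fun p => {z | z ∈ S' ∧ z ∉ S ∧ τ z < p}
  have hD : ∀ p, (D p).card ≤ X.card + X'.card + 2 * (hi - lo) + 5 := by
    intro p
    have h1 := Finset.card_union_le (X ∪ X' ∪ Z ∪ B) (A p)
    have h2 := Finset.card_union_le (X ∪ X' ∪ Z) B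
    have h3 := Finset.card_union_le (X ∪ X') Z
    have h4 := Finset.card_union_le X X'
    have h5 := h.card_le
    have h6 := hAcard p
    simp only [D]
    omega
  have hT : ∀ p, Separates G (D p) (T p) := by
    rintro p x y hx hy hxy ⟨hxS', hxS, hxp⟩
    simp only [D, Finset.mem_union, not_or] at hx hy
    obtain ⟨⟨⟨⟨hx1, hx2⟩, hx3⟩, hx4⟩, hx5⟩ := hx
    obtain ⟨⟨⟨⟨hy1, hy2⟩, hy3⟩, hy4⟩, hy5⟩ := hy
    have hyS' : y ∈ S' := hX' x y hx2 hy2 hxy hxS'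
    have hyS : y ∉ S := fun hyS => hxS (hX y x hy1 hx1 hxy.symm hyS)
    refine ⟨hyS', hyS, ?_⟩
    by_contra hyp
    rcases h.adj x y hx3 hy3 hxy with ⟨t, ht | ht⟩ | ⟨hch, -⟩
    · exact hx5 (hA p t x y ht (hlo x hxS' hxS) (hhi x hxS' hxS) hxp (not_lt.1 hyp))
    · have := ht.2.2.1
      omega
    · rcases hch with hch | hch
      · exact hx4 (hB x hch (hlo x hxS' hxS) (hhi x hxS' hxS))
      · exact hy4 (hB y hch (hlo y hyS' hyS) (hhi y hyS' hyS))
  have hstart : ¬ IsMesh.Inside m R (D 0) (T 0) := by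
    rintro ⟨i, hi', -, hsub⟩
    obtain ⟨a, ha, -⟩ := hm.meet i hi' i hi'
    exact absurd (hsub ha).2.2 (by omega)
  obtain ⟨N, hN⟩ : ∃ N, ∀ z, τ z < N :=
    ⟨Finset.univ.sup τ + 1, fun z => Nat.lt_succ_of_le (Finset.le_sup (Finset.mem_univ z))⟩
  have hend : IsMesh.Inside m R (D N) (T N) := by
    obtain ⟨i, hi', hiD⟩ := hm.exists_row (X := D N) (by have := hD N; omega)
    simp only [D, Finset.mem_union, not_or] at hiD
    have h1 := hm.row_subset hX' (by omega) hin hi' fun x hx => (hiD x hx).1.1.1.2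
    have h2 := hm.row_not_mem hX hout hi' fun x hx => (hiD x hx).1.1.1.1
    refine ⟨i, hi', fun x hx => ?_, fun x hx => ⟨h1 hx, h2 x hx, hN x⟩⟩
    simp only [D, Finset.mem_union, not_or]
    exact hiD x hx
  -- At the moment of the change, a row avoiding both separators lies in the difference of `T (p +
  -- 1)` and `T p`, which is at most the one point of time `p`; this point can be avoided too.
  obtain ⟨p, hp, hp'⟩ : ∃ p, ¬ IsMesh.Inside m R (D p) (T p) ∧
      IsMesh.Inside m R (D (p + 1)) (T (p + 1)) := by
    by_contra! hcon
    have : ∀ p, ¬ IsMesh.Inside m R (D p) (T p) := fun p => by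
      induction p with
      | zero => exact hstart
      | succ p ih => exact hcon p ih
    exact this N hend
  have hone : (Finset.univ.filter fun z => τ z = p).card ≤ 1 := by
    rw [Finset.card_le_one]
    intro x hx y hy
    simp only [Finset.mem_filter, Finset.mem_univ, true_and] at hx hy
    exact h.time_injective (hx.trans hy.symm)
  obtain ⟨i, hi', hiD⟩ := hm.exists_row (X := D p ∪ D (p + 1) ∪ Finset.univ.filter fun z => τ z = p)
    (by
      have h1 := Finset.card_union_le (D p ∪ D (p + 1)) (Finset.univ.filter fun z => τ z = p)
      have h2 := Finset.card_union_le (D p) (D (p + 1))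
      have h3 := hD p
      have h4 := hD (p + 1)
      omega)
  simp only [Finset.mem_union, not_or, Finset.mem_filter, Finset.mem_univ, true_and] at hiD
  have h1 := hm.row_subset (hT (p + 1)) (by have := hD (p + 1); omega) hp' hi'
    fun x hx => (hiD x hx).1.2
  have h2 := hm.row_not_mem (hT p) hp hi' fun x hx => (hiD x hx).1.1
  obtain ⟨a, ha, -⟩ := hm.meet i hi' i hi'
  have h3 := h1 ha
  have h4 := h2 a ha
  refine (hiD a ha).2 ?_
  by_contra hne
  exact h4 ⟨h3.1, h3.2.1, by have := h3.2.2; omega⟩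

/-- Windows start after an even index, so that their first block has the parity of the first block
of the track. -/
theorem exists_wave_nonempty (h : IsStripGraph G β τ chain Z) {m k : ℕ} {R C : ℕ → Set V}
    (hm : IsMesh G m R C) (hk : 1 ≤ k) (hmk : 299 * k ≤ m) :
    ∃ s, Even s ∧ ∀ i, s < i → i ≤ s + k → (wave β τ (3 * k) i).Nonempty := by
  classical
  by_contra! hno
  have hsep : ∀ s, Even s → ∃ (X : Finset V) (S : Set V), X.card ≤ 9 * k + 11 ∧
      Separates G X S ∧ (∀ z, β z + 3 * k < s → z ∈ S) ∧ ∀ z ∈ S, β z ≤ s + 4 * k := by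
    intro s hs
    obtain ⟨i, hsi, hisk, hempty⟩ := hno s hs
    by_cases hi : 3 * k < i
    · obtain ⟨X, S, hX, hS, h1, h2⟩ := h.exists_separates_of_wave_eq_empty _ _ hi hempty
      refine ⟨X, S, by omega, hS, fun z hz => h1 z (by omega), fun z hz => ?_⟩
      have := h2 z hz
      omega
    -- Too close to the start of the strip, no block has to be on the left and the empty set will
    -- do.
    · exact ⟨∅, ∅, by simp, fun x y _ _ _ hx => hx, fun z hz => by omega, fun z hz => hz.elim⟩
  let P : ℕ → Prop := fun q => ∃ (X : Finset V) (S : Set V), X.card ≤ 9 * k + 11 ∧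
      Separates G X S ∧ (∀ z, β z + 3 * k < 2 * q → z ∈ S) ∧ (∀ z ∈ S, β z ≤ 2 * q + 4 * k) ∧
      ¬ IsMesh.Inside m R X S
  have hP0 : P 0 := by
    refine ⟨∅, ∅, by simp, fun x y _ _ _ hx => hx, fun z hz => by omega, fun z hz => hz.elim, ?_⟩
    rintro ⟨i, hi, -, hsub⟩
    obtain ⟨a, ha, -⟩ := hm.meet i hi i hi
    exact hsub ha
  have hPs : ∀ q, P q → P (q + 1) := by
    rintro q ⟨X, S, hXc, hX, hlo, hhi, hout⟩
    obtain ⟨X', S', hXc', hX', hlo', hhi'⟩ := hsep (2 * (q + 1)) (even_two_mul _)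
    refine ⟨X', S', hXc', hX', hlo', hhi', fun hin => hout ?_⟩
    -- Two separators of size `9 * k + 11` and width at most `7 * k + 2` require `64 * k + 63 < m`.
    refine h.inside_of_inside hm (lo := 2 * q - 3 * k) (hi := 2 * (q + 1) + 4 * k) hX hX' ?_
      (fun z hz _ => hhi' z hz) (by omega) (by omega) hin
    intro z _ hzS
    by_contra hlt
    exact hzS (hlo z (by omega))
  have hP : ∀ q, P q := fun q => by
    induction q with
    | zero => exact hP0
    | succ q ih => exact hPs q ih
  obtain ⟨X, S, hXc, hX, hlo, -, hout⟩ := hP (Finset.univ.sup β + 3 * k + 1)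
  obtain ⟨i, hi, hiX⟩ := hm.exists_row (X := X) (by omega)
  refine hout ⟨i, hi, hiX, fun x _ => hlo x ?_⟩
  have := Finset.le_sup (f := β) (Finset.mem_univ x)
  omega

end IsStripGraph

/-! ### Grids from high waves -/

/-- A grid of points as in a track: `a i j` belongs to block `s + i`, and the orders of consecutive
blocks are those of the track. -/
structure IsTrackGrid {V : Type*} (β τ : V → ℕ) (s k : ℕ) (a : ℕ → ℕ → V) : Prop where
  block : ∀ i < k, ∀ j < k, β (a i j) = s + i
  right : ∀ i j, i + 1 < k → j < k → τ (a i j) < τ (a (i + 1) j)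
  up : ∀ i j, i + 1 < k → j + 1 < k → τ (a (i + 1) j) < τ (a i (j + 1))
  same : ∀ i j, i < k → j + 1 < k → τ (a i j) < τ (a i (j + 1))

/-- Take for `a i j` the first point of wave `i + 2 * j`, at most `3 * k`: a step right climbs one
wave, and so does the step back to the next point of the previous block. -/
theorem exists_isTrackGrid {V : Type*} [Finite V] {β τ : V → ℕ} {s k : ℕ} (hk : 1 ≤ k)
    (hw : ∀ i, s ≤ i → i < s + k → (wave β τ (3 * k) i).Nonempty) :
    ∃ a, IsTrackGrid β τ s k a := by
  have hmin : ∀ i j, ∃ y, i < k → j < k → IsWaveMin β τ (i + 2 * j) (s + i) y := by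
    intro i j
    by_cases hi : i < k ∧ j < k
    · obtain ⟨y, hy⟩ := exists_isWaveMin
        ((hw (s + i) (by omega) (by omega)).mono (wave_antitone (by omega : i + 2 * j ≤ 3 * k) _))
      exact ⟨y, fun _ _ => hy⟩
    · exact ⟨(hw s le_rfl (by omega)).some, fun h1 h2 => absurd ⟨h1, h2⟩ hi⟩
  choose a ha using hmin
  refine ⟨a, fun i hi j hj => block_of_mem_wave (ha i j hi hj).1, ?_, ?_, ?_⟩
  · intro i j hi hj
    have h1 := (ha (i + 1) j hi hj).1
    rw [show i + 1 + 2 * j = (i + 2 * j) + 1 by ring] at h1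
    obtain ⟨-, ⟨x, hx, hxy⟩, -⟩ := h1
    exact ((ha i j (by omega) hj).2 x hx).trans_lt hxy
  · intro i j hi hj
    have h1 := (ha i (j + 1) (by omega) hj).1
    rw [show i + 2 * (j + 1) = (i + 1 + 2 * j) + 1 by ring] at h1
    obtain ⟨-, -, x, hx, hxy⟩ := h1
    exact ((ha (i + 1) j hi (by omega)).2 x hx).trans_lt hxy
  · intro i j hi hj
    have h1 := (ha i (j + 1) hi hj).1
    rw [show i + 2 * (j + 1) = (i + 2 * j + 1) + 1 by ring] at h1
    obtain ⟨-, -, x, hx, hxy⟩ := h1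
    obtain ⟨-, ⟨w, hw', hwx⟩, -⟩ := hx
    exact (((ha i j hi (by omega)).2 w hw').trans_lt hwx).trans hxy

end PermPattern

namespace PermPattern

/-! ### The center of a skew-merged permutation -/

theorem contains_of_strictMono {n k : ℕ} {π : Equiv.Perm (Fin n)} {σ : Equiv.Perm (Fin k)}
    {f : Fin k → Fin n} (hf : StrictMono f) (h : ∀ a b, σ a < σ b → π (f a) < π (f b)) :
    Contains π σ := by
  refine ⟨f, hf, fun a b => ⟨fun hab => ?_, h a b⟩⟩
  by_contra hle
  rcases lt_or_eq_of_le (not_lt.1 hle) with h1 | h1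
  · exact lt_asymm hab (h b a h1)
  · rw [σ.injective h1] at hab
    exact lt_irrefl _ hab

theorem strictMono_vec4 {n : ℕ} {a b c d : Fin n} (hab : a < b) (hbc : b < c) (hcd : c < d) :
    StrictMono ![a, b, c, d] := by
  rw [Fin.strictMono_iff_lt_succ]
  intro i
  fin_cases i
  · exact hab
  · exact hbc
  · exact hcd

theorem contains_p2143 {n : ℕ} {π : Equiv.Perm (Fin n)} {a b c d : Fin n} (hab : a < b)
    (hbc : b < c) (hcd : c < d) (h1 : π b < π a) (h2 : π a < π d) (h3 : π d < π c) :
    Contains π p2143 := by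
  refine contains_of_strictMono (strictMono_vec4 hab hbc hcd) fun i j => ?_
  fin_cases i <;> fin_cases j <;> simp [p2143] <;> omega

theorem contains_p3412 {n : ℕ} {π : Equiv.Perm (Fin n)} {a b c d : Fin n} (hab : a < b)
    (hbc : b < c) (hcd : c < d) (h1 : π c < π d) (h2 : π d < π a) (h3 : π a < π b) :
    Contains π p3412 := by
  refine contains_of_strictMono (strictMono_vec4 hab hbc hcd) fun i j => ?_
  fin_cases i <;> fin_cases j <;> simp [p3412] <;> omega

theorem contains_p3142 {n : ℕ} {π : Equiv.Perm (Fin n)} {a b c d : Fin n} (hab : a < b)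
    (hbc : b < c) (hcd : c < d) (h1 : π b < π d) (h2 : π d < π a) (h3 : π a < π c) :
    Contains π p3142 := by
  refine contains_of_strictMono (strictMono_vec4 hab hbc hcd) fun i j => ?_
  fin_cases i <;> fin_cases j <;> simp [p3142] <;> omega

/-- The lines through `(L, M)` divide the elements into two increasing sequences (below left and
above right) and two decreasing ones. -/
structure IsCenter {n : ℕ} (π : Equiv.Perm (Fin n)) (L M : ℕ) : Prop where
  above_left : ∀ i j : Fin n, i < j → (j : ℕ) < L → M ≤ (π i : ℕ) → π j < π i
  below_left : ∀ i j : Fin n, i < j → (j : ℕ) < L → (π i : ℕ) < M → π i < π j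
  below_right : ∀ i j : Fin n, i < j → L ≤ (i : ℕ) → (π j : ℕ) < M → π j < π i
  above_right : ∀ i j : Fin n, i < j → L ≤ (i : ℕ) → M ≤ (π j : ℕ) → π i < π j

/-- On the left, lower ends of ascents must be below the horizontal line and upper ends of descents
above it; on the right, lower ends of descents below and upper ends of ascents above. A line exists
once every point of the first kind is below every point of the second. -/
theorem exists_isCenter {n : ℕ} {π : Equiv.Perm (Fin n)} (h2143 : ¬ Contains π p2143)
    (h3412 : ¬ Contains π p3412) : ∃ L M, IsCenter π L M := by
  classical
  have hne : ∀ {i j : Fin n}, i < j → π i ≠ π j := fun hij h => hij.ne (π.injective h)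
  let P : ℕ → Prop := fun L => ∀ a b c d : Fin n, a < b → π a < π b → (b : ℕ) < L → c < d →
    π d < π c → (d : ℕ) < L → π a < π c
  have hP0 : P 0 := fun a b c d _ _ hb => by omega
  obtain ⟨L, hL, hmax⟩ : ∃ L, P L ∧ (L < n → ¬ P (L + 1)) :=
    ⟨Nat.findGreatest P n, Nat.findGreatest_spec (P := P) (Nat.zero_le n) hP0, fun h =>
      Nat.findGreatest_is_greatest (Nat.lt_succ_self _) h⟩
  have hβα : ∀ c d i j : Fin n, c < d → π d < π c → (d : ℕ) < L → i < j → π j < π i →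
      L ≤ (i : ℕ) → π j < π c := by
    intro c d i j hcd hdc hd hij hji hi
    by_contra hle
    have := hne (show c < j by omega)
    exact h2143 (contains_p2143 hcd (by omega) hij hdc (by omega) hji)
  have hγδ : ∀ a b i j : Fin n, a < b → π a < π b → (b : ℕ) < L → i < j → π i < π j →
      L ≤ (i : ℕ) → π a < π j := by
    intro a b i j hab hab' hb hij hji hi
    by_contra hle
    have := hne (show a < j by omega)
    exact h3412 (contains_p3412 hab (by omega) hij hji (by omega) hab')
  -- Maximality of `L` supplies a conflicting ascent and descent just to the left. Together with a
  -- conflict on the right they give 2143 or 3412, unless two values at different positions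
  -- coincide.
  have hβδ : ∀ i j i' j' : Fin n, i < j → π j < π i → L ≤ (i : ℕ) → i' < j' → π i' < π j' →
      L ≤ (i' : ℕ) → π j < π j' := by
    intro i j i' j' hij hji hi hij' hji' hi'
    by_contra hle
    have hnP := hmax (by omega)
    simp only [P, not_forall] at hnP
    obtain ⟨a, b, c, d, hab, hab', hb, hcd, hdc, hd, hac⟩ := hnP
    have h1 : ¬ π c < π j := fun h => by
      have hdi : d ≠ i := by rintro rfl; omega
      exact h2143 (contains_p2143 hcd (by omega) hij hdc h hji)
    have h2 : ¬ π j' < π a := fun h => by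
      have hbi : b ≠ i' := by rintro rfl; omega
      exact h3412 (contains_p3412 hab (by omega) hij' hji' h hab')
    have h3 : π a = π j := by omega
    have := π.injective h3
    omega
  let A : Finset (Fin n) := Finset.univ.filter fun x =>
    (∃ a b : Fin n, a < b ∧ π a < π b ∧ (b : ℕ) < L ∧ x = π a) ∨
    ∃ i j : Fin n, i < j ∧ π j < π i ∧ L ≤ (i : ℕ) ∧ x = π j
  refine ⟨L, A.sup fun x => (x : ℕ) + 1, ?_, ?_, ?_, ?_⟩
  · intro i j hij hj hM
    by_contra hle
    have := hne hij
    have : (π i : ℕ) + 1 ≤ A.sup fun x => (x : ℕ) + 1 := Finset.le_sup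
      (f := fun x : Fin n => (x : ℕ) + 1)
      (by simp only [A, Finset.mem_filter, Finset.mem_univ, true_and]
          exact Or.inl ⟨i, j, hij, by omega, hj, rfl⟩)
    omega
  · intro i j hij hj hM
    by_contra hle
    have := hne hij
    have : (A.sup fun x => (x : ℕ) + 1) ≤ π i := by
      refine Finset.sup_le fun x hx => ?_
      simp only [A, Finset.mem_filter, Finset.mem_univ, true_and] at hx
      rcases hx with ⟨a, b, hab, hab', hb, rfl⟩ | ⟨i', j', hij', hji', hi', rfl⟩
      · exact hL a b i j hab hab' hb hij (by omega) hj
      · exact hβα i j i' j' hij (by omega) hj hij' hji' hi'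
    omega
  · intro i j hij hi hM
    by_contra hle
    have := hne hij
    have : (A.sup fun x => (x : ℕ) + 1) ≤ π j := by
      refine Finset.sup_le fun x hx => ?_
      simp only [A, Finset.mem_filter, Finset.mem_univ, true_and] at hx
      rcases hx with ⟨a, b, hab, hab', hb, rfl⟩ | ⟨i', j', hij', hji', hi', rfl⟩
      · exact hγδ a b i j hab hab' hb hij (by omega) hi
      · exact hβδ i' j' i j hij' hji' hi' hij (by omega) hi
    omega
  · intro i j hij hi hM
    by_contra hle
    have := hne hij
    have : (π j : ℕ) + 1 ≤ A.sup fun x => (x : ℕ) + 1 := Finset.le_sup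
      (f := fun x : Fin n => (x : ℕ) + 1)
      (by simp only [A, Finset.mem_filter, Finset.mem_univ, true_and]
          exact Or.inr ⟨i, j, hij, by omega, hi, rfl⟩)
    omega

/-- The arms around a center, counterclockwise: `1` above left, `2` below left, `3` below right and
`0` above right. The vertices are the values. -/
def centerArm {n : ℕ} (π : Equiv.Perm (Fin n)) (L M : ℕ) (z : Fin n) : ℕ :=
  if (π.symm z : ℕ) < L then (if (z : ℕ) < M then 2 else 1) else (if (z : ℕ) < M then 3 else 0)

/-- The depth in the rows (for even `i`) or in the columns (for odd `i`). -/
def centerKey {n : ℕ} (π : Equiv.Perm (Fin n)) (L M i : ℕ) (z : Fin n) : ℕ :=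
  if i % 2 = 1 then (if (π.symm z : ℕ) < L then (π.symm z : ℕ) else n - (π.symm z : ℕ))
  else (if (z : ℕ) < M then (z : ℕ) else n - z)

theorem centerArm_cases {n : ℕ} (π : Equiv.Perm (Fin n)) (L M : ℕ) (z : Fin n) :
    ((π.symm z : ℕ) < L ∧ M ≤ (z : ℕ) ∧ centerArm π L M z = 1) ∨
    ((π.symm z : ℕ) < L ∧ (z : ℕ) < M ∧ centerArm π L M z = 2) ∨
    (L ≤ (π.symm z : ℕ) ∧ (z : ℕ) < M ∧ centerArm π L M z = 3) ∨
    (L ≤ (π.symm z : ℕ) ∧ M ≤ (z : ℕ) ∧ centerArm π L M z = 0) := by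
  unfold centerArm
  split_ifs <;> omega

theorem centerKey_cases {n : ℕ} (π : Equiv.Perm (Fin n)) (L M i : ℕ) (z : Fin n) :
    (i % 2 = 1 ∧ (π.symm z : ℕ) < L ∧ centerKey π L M i z = π.symm z) ∨
    (i % 2 = 1 ∧ L ≤ (π.symm z : ℕ) ∧ centerKey π L M i z = n - π.symm z) ∨
    (i % 2 = 0 ∧ (z : ℕ) < M ∧ centerKey π L M i z = z) ∨
    (i % 2 = 0 ∧ M ≤ (z : ℕ) ∧ centerKey π L M i z = n - z) := by
  unfold centerKey
  split_ifs <;> omega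

/-- Read from left to right, the points `a`, `b`, `d`, `c` of such a cycle form 3142. -/
theorem center_acyclic {n : ℕ} {π : Equiv.Perm (Fin n)} {L M : ℕ} (h3142 : ¬ Contains π p3142)
    {a b c d : Fin n} (ha : centerArm π L M a = 1) (hb : centerArm π L M b = 2)
    (hc : centerArm π L M c = 3) (hd : centerArm π L M d = 0)
    (hab : centerKey π L M 1 a < centerKey π L M 1 b)
    (hbc : centerKey π L M 2 b < centerKey π L M 2 c)
    (hcd : centerKey π L M 3 c < centerKey π L M 3 d)
    (hda : centerKey π L M 0 d < centerKey π L M 0 a) : False := by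
  have ha' := centerArm_cases π L M a
  have hb' := centerArm_cases π L M b
  have hc' := centerArm_cases π L M c
  have hd' := centerArm_cases π L M d
  have hab' : (π.symm a : ℕ) < π.symm b := by
    have h1 := centerKey_cases π L M 1 a
    have h2 := centerKey_cases π L M 1 b
    omega
  have hbc' : (b : ℕ) < c := by
    have h1 := centerKey_cases π L M 2 b
    have h2 := centerKey_cases π L M 2 c
    omega
  have hcd' : (π.symm d : ℕ) < π.symm c := by
    have h1 := centerKey_cases π L M 3 c
    have h2 := centerKey_cases π L M 3 d
    omega
  have hda' : (a : ℕ) < d := by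
    have h1 := centerKey_cases π L M 0 d
    have h2 := centerKey_cases π L M 0 a
    omega
  refine h3142 (contains_p3142 (a := π.symm a) (b := π.symm b) (c := π.symm d) (d := π.symm c)
    ?_ ?_ ?_ ?_ ?_ ?_) <;> rw [Fin.lt_def] <;> (try simp only [Equiv.apply_symm_apply]) <;> omega

/-- Each arm is monotone in the direction that points to the center, so depth by rows and depth by
columns agree on it. -/
theorem centerKey_succ {n : ℕ} {π : Equiv.Perm (Fin n)} {L M : ℕ} (h : IsCenter π L M) (i : ℕ)
    {x y : Fin n} (hxy : centerArm π L M x = centerArm π L M y) :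
    centerKey π L M i x < centerKey π L M i y ↔
      centerKey π L M (i + 1) x < centerKey π L M (i + 1) y := by
  have h1 := h.above_left (π.symm x) (π.symm y)
  have h2 := h.above_left (π.symm y) (π.symm x)
  have h3 := h.below_left (π.symm x) (π.symm y)
  have h4 := h.below_left (π.symm y) (π.symm x)
  have h5 := h.below_right (π.symm x) (π.symm y)
  have h6 := h.below_right (π.symm y) (π.symm x)
  have h7 := h.above_right (π.symm x) (π.symm y)
  have h8 := h.above_right (π.symm y) (π.symm x)
  have hπ : (π.symm x : ℕ) = π.symm y → (x : ℕ) = y := fun e =>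
    congrArg _ (π.symm.injective (Fin.ext e))
  simp only [Equiv.apply_symm_apply, Fin.lt_def] at h1 h2 h3 h4 h5 h6 h7 h8
  have lx := x.2
  have ly := y.2
  have lpx := (π.symm x).2
  have lpy := (π.symm y).2
  have ax := centerArm_cases π L M x
  have ay := centerArm_cases π L M y
  have k1 := centerKey_cases π L M i x
  have k2 := centerKey_cases π L M i y
  have k3 := centerKey_cases π L M (i + 1) x
  have k4 := centerKey_cases π L M (i + 1) y
  generalize (π.symm x : ℕ) = px at *
  generalize (π.symm y : ℕ) = py at *
  generalize (x : ℕ) = vx at *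
  generalize (y : ℕ) = vy at *
  generalize centerKey π L M i x = k1x at *
  generalize centerKey π L M i y = k1y at *
  generalize centerKey π L M (i + 1) x = k2x at *
  generalize centerKey π L M (i + 1) y = k2y at *
  generalize centerArm π L M x = arx at *
  generalize centerArm π L M y = ary at *
  clear h
  rcases ax with ax | ax | ax | ax
  · clear h3 h4 h5 h6 h7 h8
    obtain ⟨ay1, ay2⟩ : py < L ∧ M ≤ vy := by omega
    clear ay hxy
    rcases Nat.mod_two_eq_zero_or_one i with hi | hi <;> omega
  · clear h1 h2 h5 h6 h7 h8
    obtain ⟨ay1, ay2⟩ : py < L ∧ vy < M := by omega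
    clear ay hxy
    rcases Nat.mod_two_eq_zero_or_one i with hi | hi <;> omega
  · clear h1 h2 h3 h4 h7 h8
    obtain ⟨ay1, ay2⟩ : L ≤ py ∧ vy < M := by omega
    clear ay hxy
    rcases Nat.mod_two_eq_zero_or_one i with hi | hi <;> omega
  · clear h1 h2 h3 h4 h5 h6
    obtain ⟨ay1, ay2⟩ : L ≤ py ∧ M ≤ vy := by omega
    clear ay hxy
    rcases Nat.mod_two_eq_zero_or_one i with hi | hi <;> omega

theorem center_acyclic_rotate {n : ℕ} {π : Equiv.Perm (Fin n)} {L M : ℕ}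
    (h3142 : ¬ Contains π p3142) (i : ℕ) {a b c d : Fin n}
    (ha : centerArm π L M a % 4 = i % 4) (hb : centerArm π L M b % 4 = (i + 1) % 4)
    (hc : centerArm π L M c % 4 = (i + 2) % 4) (hd : centerArm π L M d % 4 = (i + 3) % 4)
    (hab : centerKey π L M i a < centerKey π L M i b)
    (hbc : centerKey π L M (i + 1) b < centerKey π L M (i + 1) c)
    (hcd : centerKey π L M (i + 2) c < centerKey π L M (i + 2) d)
    (hda : centerKey π L M (i + 3) d < centerKey π L M (i + 3) a) : False := by
  have hkey : ∀ {j l z}, j % 2 = l % 2 → centerKey π L M j z = centerKey π L M l z := by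
    intro j l z hjl
    unfold centerKey
    rw [hjl]
  have harm : ∀ z, centerArm π L M z < 4 := fun z => by
    unfold centerArm
    split_ifs <;> omega
  have la := harm a
  have lb := harm b
  have lc := harm c
  have ld := harm d
  have hlt : ∀ j l z w, centerKey π L M j z < centerKey π L M j w → j % 2 = l % 2 →
      centerKey π L M l z < centerKey π L M l w := by
    intro j l z w hzw hjl
    rwa [hkey hjl, hkey hjl] at hzw
  clear hkey harm
  have key0 : ∀ l, l % 2 = i % 2 → _ := fun l hl => hlt i l a b hab hl.symm
  have key1 : ∀ l, l % 2 = (i + 1) % 2 → _ := fun l hl => hlt (i + 1) l b c hbc hl.symm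
  have key2 : ∀ l, l % 2 = (i + 2) % 2 → _ := fun l hl => hlt (i + 2) l c d hcd hl.symm
  have key3 : ∀ l, l % 2 = (i + 3) % 2 → _ := fun l hl => hlt (i + 3) l d a hda hl.symm
  clear hlt hab hbc hcd hda
  generalize hA : centerArm π L M a = A at *
  generalize hB : centerArm π L M b = B at *
  generalize hC : centerArm π L M c = C at *
  generalize hD : centerArm π L M d = D at *
  obtain hi | hi | hi | hi : i % 4 = 0 ∨ i % 4 = 1 ∨ i % 4 = 2 ∨ i % 4 = 3 := by omega
  · exact center_acyclic h3142 (hB.trans (by omega)) (hC.trans (by omega)) (hD.trans (by omega))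
      (hA.trans (by omega)) (key1 1 (by omega)) (key2 2 (by omega)) (key3 3 (by omega))
      (key0 0 (by omega))
  · exact center_acyclic h3142 (hA.trans (by omega)) (hB.trans (by omega)) (hC.trans (by omega))
      (hD.trans (by omega)) (key0 1 (by omega)) (key1 2 (by omega)) (key2 3 (by omega))
      (key3 0 (by omega))
  · exact center_acyclic h3142 (hD.trans (by omega)) (hA.trans (by omega)) (hB.trans (by omega))
      (hC.trans (by omega)) (key3 1 (by omega)) (key0 2 (by omega)) (key1 3 (by omega))
      (key2 0 (by omega))
  · exact center_acyclic h3142 (hC.trans (by omega)) (hD.trans (by omega)) (hA.trans (by omega))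
      (hB.trans (by omega)) (key2 1 (by omega)) (key3 2 (by omega)) (key0 3 (by omega))
      (key1 0 (by omega))

/-- The spiralling system of a skew-merged permutation without `3142`. -/
def centerSystem {n : ℕ} {π : Equiv.Perm (Fin n)} {L M : ℕ} (h : IsCenter π L M)
    (h3142 : ¬ Contains π p3142) : SpiralSystem (Fin n) where
  arm := centerArm π L M
  key := centerKey π L M
  key_mod i z := by
    unfold centerKey
    rw [show (i + 4) % 2 = i % 2 by omega]
  key_inj i x y hx hy hxy := by
    have hπ : (π.symm x : ℕ) = π.symm y → x = y := fun e => π.symm.injective (Fin.ext e)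
    have hv : (x : ℕ) = y → x = y := Fin.ext
    have h1 := centerArm_cases π L M x
    have h2 := centerArm_cases π L M y
    rcases centerKey_cases π L M i x with h3 | h3 | h3 | h3 <;>
      rcases centerKey_cases π L M i y with h4 | h4 | h4 | h4 <;>
      first
        | (apply hπ; omega)
        | (apply hv; omega)
  key_succ i x y hx hy := by
    have h1 := centerArm_cases π L M x
    have h2 := centerArm_cases π L M y
    exact centerKey_succ h i (by omega)
  acyclic i a b c d ha hb hc hd hab hbc hcd hda :=
    center_acyclic_rotate h3142 i ha hb hc hd hab hbc hcd hda

end PermPattern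

namespace PermPattern

/-! ### The graph of a skew-merged permutation without `3142` -/

namespace SpiralSystem

variable {V : Type*} [Fintype V] (Y : SpiralSystem V)

/-- The times of the points of a spiralling system: on two consecutive blocks, the order of times
is the order of keys. -/
def IsTime (τ : V → ℕ) : Prop :=
  ∀ i x y, (Y.block x = i ∨ Y.block x = i + 1) → (Y.block y = i ∨ Y.block y = i + 1) →
    (Y.key i x < Y.key i y ↔ τ x < τ y)

theorem consecutive_or_chain {τ : V → ℕ} (hτ : Y.IsTime τ) {i : ℕ} {x y : V}
    (hx : Y.arm x % 4 = i % 4 ∨ Y.arm x % 4 = (i + 1) % 4)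
    (hy : Y.arm y % 4 = i % 4 ∨ Y.arm y % 4 = (i + 1) % 4) (hxy : Y.key i y = Y.key i x + 1) :
    (∃ t, Consecutive Y.block τ t x y) ∨
      (Y.IsChain y ∧ Y.block x ≤ Y.block y + 4 ∧ Y.block y ≤ Y.block x + 4) := by
  rcases Y.block_of_consecutive hx hy (by omega) (fun w _ h => by omega) with
    ⟨j, hj, hxj, hyj⟩ | ⟨h1, h2, h3⟩
  · left
    have hk := fun z => Y.key_congr hj z
    refine ⟨j, hxj, hyj, (hτ j x y hxj hyj).1 (by rw [hk, hk]; omega), fun w hw hxw => ?_⟩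
    have h1 := (hτ j x w hxj hw).2 hxw
    by_contra hlt
    have h2 := (hτ j w y hw hyj).2 (not_le.1 hlt)
    rw [hk, hk] at h1 h2
    omega
  · exact Or.inr ⟨h1, by omega, by omega⟩

end SpiralSystem

theorem card_filter_val_eq_le_one {n : ℕ} (π : Equiv.Perm (Fin n)) (L : ℕ) :
    (Finset.univ.filter fun z => (π z : ℕ) = L).card ≤ 1 := by
  rw [Finset.card_le_one]
  intro x hx y hy
  simp only [Finset.mem_filter, Finset.mem_univ, true_and] at hx hy
  exact π.injective (Fin.ext (hx.trans hy.symm))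

section Center

variable {n : ℕ} {π : Equiv.Perm (Fin n)} {L M : ℕ} (h : IsCenter π L M)
  (h3142 : ¬ Contains π p3142)

/-- Neighbouring columns on the same side of the vertical line have consecutive depths. The
exception is the pair astride the line, whose right member is at position `L`. -/
theorem exists_key_eq_add_one_of_pos {x y : Fin n} (hxy : (π.symm y : ℕ) = π.symm x + 1)
    (hy : (π.symm y : ℕ) ≠ L) :
    ∃ i, (centerArm π L M x % 4 = i % 4 ∨ centerArm π L M x % 4 = (i + 1) % 4) ∧
      (centerArm π L M y % 4 = i % 4 ∨ centerArm π L M y % 4 = (i + 1) % 4) ∧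
      (centerKey π L M i y = centerKey π L M i x + 1 ∨
        centerKey π L M i x = centerKey π L M i y + 1) := by
  have ax := centerArm_cases π L M x
  have ay := centerArm_cases π L M y
  have ly := (π.symm y).2
  by_cases hl : (π.symm y : ℕ) < L
  · refine ⟨1, by omega, by omega, Or.inl ?_⟩
    simp only [centerKey, hl, show (π.symm x : ℕ) < L by omega, if_true]
    exact hxy
  · refine ⟨3, by omega, by omega, Or.inr ?_⟩
    simp only [centerKey, hl, show ¬ (π.symm x : ℕ) < L by omega, if_false]
    norm_num
    omega

theorem exists_key_eq_add_one_of_val {x y : Fin n} (hxy : (y : ℕ) = x + 1) (hy : (y : ℕ) ≠ M) :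
    ∃ i, (centerArm π L M x % 4 = i % 4 ∨ centerArm π L M x % 4 = (i + 1) % 4) ∧
      (centerArm π L M y % 4 = i % 4 ∨ centerArm π L M y % 4 = (i + 1) % 4) ∧
      (centerKey π L M i y = centerKey π L M i x + 1 ∨
        centerKey π L M i x = centerKey π L M i y + 1) := by
  have ax := centerArm_cases π L M x
  have ay := centerArm_cases π L M y
  have ly := y.2
  by_cases hl : (y : ℕ) < M
  · refine ⟨2, by omega, by omega, Or.inl ?_⟩
    simp only [centerKey, hl, show (x : ℕ) < M by omega, if_true]
    norm_num
    omega
  · refine ⟨0, by omega, by omega, Or.inr ?_⟩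
    simp only [centerKey, hl, show ¬ (x : ℕ) < M by omega, if_false]
    norm_num
    omega

theorem isStripGraph_permGraph {τ : Fin n → ℕ} (hinj : Function.Injective τ)
    (hτ : (centerSystem h h3142).IsTime τ) :
    IsStripGraph (permGraph π) (centerSystem h h3142).block τ
      {z | (centerSystem h h3142).IsChain z}
      ((Finset.univ.filter fun z => (π.symm z : ℕ) = L) ∪
        Finset.univ.filter fun z : Fin n => (z : ℕ) = M) := by
  refine ⟨hinj, ?_, fun x hx y hy => SpiralSystem.IsChain.eq _ hx hy, ?_⟩
  · have h1 := card_filter_val_eq_le_one π.symm L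
    have h2 := card_filter_val_eq_le_one (Equiv.refl (Fin n)) M
    exact (Finset.card_union_le _ _).trans (Nat.add_le_add h1 h2)
  · intro x y hx hy hxy
    simp only [Finset.mem_union, Finset.mem_filter, Finset.mem_univ, true_and, not_or] at hx hy
    obtain ⟨i, hxi, hyi, hi⟩ : ∃ i,
        (centerArm π L M x % 4 = i % 4 ∨ centerArm π L M x % 4 = (i + 1) % 4) ∧
        (centerArm π L M y % 4 = i % 4 ∨ centerArm π L M y % 4 = (i + 1) % 4) ∧
        (centerKey π L M i y = centerKey π L M i x + 1 ∨
          centerKey π L M i x = centerKey π L M i y + 1) := by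
      have hd : ((π.symm y : ℕ) = π.symm x + 1 ∨ (π.symm x : ℕ) = π.symm y + 1) ∨
          ((y : ℕ) = x + 1 ∨ (x : ℕ) = y + 1) := by
        simp only [permGraph, Nat.dist] at hxy
        omega
      rcases hd with (hd | hd) | (hd | hd)
      · exact exists_key_eq_add_one_of_pos hd hy.1
      · obtain ⟨i, h1, h2, h3⟩ := exists_key_eq_add_one_of_pos (M := M) hd hx.1
        exact ⟨i, h2, h1, h3.symm⟩
      · exact exists_key_eq_add_one_of_val hd hy.2
      · obtain ⟨i, h1, h2, h3⟩ := exists_key_eq_add_one_of_val (L := L) hd hx.2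
        exact ⟨i, h2, h1, h3.symm⟩
    rcases hi with hi | hi
    · rcases (centerSystem h h3142).consecutive_or_chain hτ hxi hyi hi with ⟨t, ht⟩ | ⟨h1, h2⟩
      · exact Or.inl ⟨t, Or.inl ht⟩
      · exact Or.inr ⟨Or.inr h1, h2⟩
    · rcases (centerSystem h h3142).consecutive_or_chain hτ hyi hxi hi with ⟨t, ht⟩ | ⟨h1, h2⟩
      · exact Or.inl ⟨t, Or.inr ht⟩
      · exact Or.inr ⟨Or.inl h1, h2.2, h2.1⟩

/-! ### Order of positions and values in terms of blocks and keys -/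

theorem pos_lt_of_key_lt_left {x y : Fin n} {c : ℕ} (hc : c % 4 = 1)
    (hx : centerArm π L M x % 4 = 1 ∨ centerArm π L M x % 4 = 2)
    (hy : centerArm π L M y % 4 = 1 ∨ centerArm π L M y % 4 = 2)
    (hxy : centerKey π L M c x < centerKey π L M c y) : π.symm x < π.symm y := by
  have ax := centerArm_cases π L M x
  have ay := centerArm_cases π L M y
  have kx := centerKey_cases π L M c x
  have ky := centerKey_cases π L M c y
  rw [Fin.lt_def]
  omega

theorem pos_lt_of_key_lt_right {x y : Fin n} {c : ℕ} (hc : c % 4 = 3)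
    (hx : centerArm π L M x % 4 = 3 ∨ centerArm π L M x % 4 = 0)
    (hy : centerArm π L M y % 4 = 3 ∨ centerArm π L M y % 4 = 0)
    (hxy : centerKey π L M c y < centerKey π L M c x) : π.symm x < π.symm y := by
  have ax := centerArm_cases π L M x
  have ay := centerArm_cases π L M y
  have kx := centerKey_cases π L M c x
  have ky := centerKey_cases π L M c y
  rw [Fin.lt_def]
  omega

theorem pos_lt_of_arm {x y : Fin n}
    (hx : centerArm π L M x % 4 = 1 ∨ centerArm π L M x % 4 = 2)
    (hy : centerArm π L M y % 4 = 3 ∨ centerArm π L M y % 4 = 0) : π.symm x < π.symm y := by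
  have ax := centerArm_cases π L M x
  have ay := centerArm_cases π L M y
  rw [Fin.lt_def]
  omega

theorem val_lt_of_key_lt_below {x y : Fin n} {c : ℕ} (hc : c % 4 = 2)
    (hx : centerArm π L M x % 4 = 2 ∨ centerArm π L M x % 4 = 3)
    (hy : centerArm π L M y % 4 = 2 ∨ centerArm π L M y % 4 = 3)
    (hxy : centerKey π L M c x < centerKey π L M c y) : x < y := by
  have ax := centerArm_cases π L M x
  have ay := centerArm_cases π L M y
  have kx := centerKey_cases π L M c x
  have ky := centerKey_cases π L M c y
  rw [Fin.lt_def]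
  omega

theorem val_lt_of_key_lt_above {x y : Fin n} {c : ℕ} (hc : c % 4 = 0)
    (hx : centerArm π L M x % 4 = 0 ∨ centerArm π L M x % 4 = 1)
    (hy : centerArm π L M y % 4 = 0 ∨ centerArm π L M y % 4 = 1)
    (hxy : centerKey π L M c y < centerKey π L M c x) : x < y := by
  have ax := centerArm_cases π L M x
  have ay := centerArm_cases π L M y
  have kx := centerKey_cases π L M c x
  have ky := centerKey_cases π L M c y
  rw [Fin.lt_def]
  omega

theorem val_lt_of_arm {x y : Fin n}
    (hx : centerArm π L M x % 4 = 2 ∨ centerArm π L M x % 4 = 3)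
    (hy : centerArm π L M y % 4 = 0 ∨ centerArm π L M y % 4 = 1) : x < y := by
  have ax := centerArm_cases π L M x
  have ay := centerArm_cases π L M y
  rw [Fin.lt_def]
  omega

end Center

/-! ### Containment of a spiral -/

theorem contains_ofPoints {n N : ℕ} {α : Type*} [LinearOrder α] {π : Equiv.Perm (Fin n)}
    {x y : Fin N → α} (hx : Function.Injective x) (hy : Function.Injective y) (p : Fin N → Fin n)
    (hpx : ∀ e e', x e < x e' → π.symm (p e) < π.symm (p e'))
    (hpy : ∀ e e', y e < y e' → p e < p e') : Contains π (ofPoints x y) := by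
  refine contains_of_strictMono (f := fun a => π.symm (p (Tuple.sort x a))) ?_ ?_
  · intro a b hab
    refine hpx _ _ ((sort_symm_lt_iff hx _ _).1 ?_)
    simpa using hab
  · intro a b hab
    simp only [Equiv.apply_symm_apply]
    refine hpy _ _ ((sort_symm_lt_iff hy _ _).1 ?_)
    simpa [ofPoints] using hab

theorem contains_revComp_ofPoints {n N : ℕ} {α : Type*} [LinearOrder α] {π : Equiv.Perm (Fin n)}
    {x y : Fin N → α} (hx : Function.Injective x) (hy : Function.Injective y) (p : Fin N → Fin n)
    (hpx : ∀ e e', x e < x e' → π.symm (p e') < π.symm (p e))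
    (hpy : ∀ e e', y e < y e' → p e' < p e) : Contains π (revComp (ofPoints x y)) := by
  refine contains_of_strictMono (f := fun a => π.symm (p (Tuple.sort x (Fin.rev a)))) ?_ ?_
  · intro a b hab
    refine hpx _ _ ((sort_symm_lt_iff hx _ _).1 ?_)
    simpa using hab
  · intro a b hab
    simp only [Equiv.apply_symm_apply]
    refine hpy _ _ ((sort_symm_lt_iff hy _ _).1 ?_)
    simpa [ofPoints, revComp] using hab

/-- The rank of an element of the track in its block; in two consecutive blocks that share columns
or rows, the elements are ordered by rank and then by block. -/
theorem exists_track_rank (k : ℕ) : ∃ J : Fin (k ^ 2) → ℕ,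
    (∀ e, J e < k ∧ 1 ≤ trackBlock k e ∧ trackBlock k e ≤ k) ∧
    (∀ e e', (trackBlock k e + 1) / 2 = (trackBlock k e' + 1) / 2 → (e : ℕ) < e' →
      J e < J e' ∨ (J e = J e' ∧ trackBlock k e < trackBlock k e')) ∧
    ∀ e e', trackBlock k e / 2 = trackBlock k e' / 2 → (kTrack k e : ℕ) < kTrack k e' →
      J e < J e' ∨ (J e = J e' ∧ trackBlock k e < trackBlock k e') := by
  have hcase : ∀ e : Fin (k ^ 2), ∃ g j, j < k ∧
      ((k = 2 * g + 1 ∧ trackBlock k e = 2 * g + 1 ∧ (e : ℕ) = 2 * k * g + j ∧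
          trackSeq k e = 2 * k * g + 1 + 2 * j) ∨
        (2 * g + 2 ≤ k ∧ trackBlock k e = 2 * g + 1 ∧ (e : ℕ) = 2 * k * g + 2 * j ∧
          trackSeq k e = 2 * k * g + 1 + 2 * j) ∨
        (2 * g + 2 ≤ k ∧ trackBlock k e = 2 * g + 2 ∧ (e : ℕ) = 2 * k * g + 2 * j + 1 ∧
          trackSeq k e = 2 * k * (g + 1) + 2 * j)) := by
    intro e
    obtain ⟨g, s, h1, h2, h3⟩ := track_cases k e
    have h4 : 2 * k * (g + 1) = 2 * k * g + 2 * k := by ring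
    rcases h3 with h3 | h3 | h3
    · exact ⟨g, s, by omega, by omega⟩
    · exact ⟨g, s / 2, by omega, by omega⟩
    · exact ⟨g, s / 2, by omega, by omega⟩
  choose G J hJ hG using hcase
  refine ⟨J, fun e => ?_, fun e e' hb hlt => ?_, fun e e' hb hlt => ?_⟩
  · have h1 := hJ e
    have h2 := hG e
    omega
  · have h2 := hG e
    have h2' := hG e'
    have hg : G e' = G e := by omega
    rw [hg] at h2'
    generalize 2 * k * G e = A at *
    omega
  · have hlt' : trackSeq k e < trackSeq k e' :=
      (sort_symm_lt_iff (trackSeq_injective k) e e').1 hlt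
    have h2 := hG e
    have h2' := hG e'
    rcases lt_trichotomy (G e') (G e) with hg | hg | hg
    · have hg' : G e = G e' + 1 := by omega
      rw [hg'] at h2
      generalize 2 * k * (G e' + 1) = A at *
      omega
    · rw [hg] at h2'
      generalize 2 * k * (G e + 1) = A at *
      generalize 2 * k * (G e) = B at *
      omega
    · have hg' : G e' = G e + 1 := by omega
      rw [hg'] at h2'
      generalize 2 * k * (G e + 1) = A at *
      omega

/-- On two consecutive blocks the grid is ordered by rank and then by block, as in
`exists_track_rank`. -/
theorem IsTrackGrid.lt {V : Type*} {β τ : V → ℕ} {s k : ℕ} {a : ℕ → ℕ → V}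
    (h : IsTrackGrid β τ s k a) {c i j i' j' : ℕ} (hi : i < k) (hi' : i' < k) (hj : j < k)
    (hj' : j' < k) (hc : i = c ∨ i = c + 1) (hc' : i' = c ∨ i' = c + 1)
    (hlt : j < j' ∨ (j = j' ∧ i < i')) : τ (a i j) < τ (a i' j') := by
  have mono : ∀ i < k, ∀ j j', j ≤ j' → j' < k → τ (a i j) ≤ τ (a i j') := by
    intro i hi j j' hjj
    induction j', hjj using Nat.le_induction with
    | base => exact fun _ => le_rfl
    | succ l _ ih => exact fun hl => (ih (by omega)).trans (h.same i l hi hl).le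
  rcases lt_trichotomy i i' with hii | rfl | hii
  · have e : i' = i + 1 := by omega
    subst e
    exact (mono i hi j j' (by omega) hj').trans_lt (h.right i j' hi' hj')
  · have h1 := h.same i j hi (by omega)
    exact h1.trans_le (mono i hi (j + 1) j' (by omega) hj')
  · have e : i = i' + 1 := by omega
    subst e
    have h1 := h.up i' j hi (by omega)
    exact h1.trans_le (mono i' hi' (j + 1) j' (by omega) hj')

end PermPattern

namespace PermPattern

/-! ### Winding the grid up into a spiral -/

theorem contains_kSpiral_of_isTrackGrid {n k s L M : ℕ} {π : Equiv.Perm (Fin n)}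
    (h : IsCenter π L M) (h3142 : ¬ Contains π p3142) {τ : Fin n → ℕ}
    (hτ : (centerSystem h h3142).IsTime τ) {a : ℕ → ℕ → Fin n} (hs : Even s)
    (ha : IsTrackGrid (centerSystem h h3142).block τ (s + 1) k a) :
    Contains π (kSpiral k) ∨ Contains π (revComp (kSpiral k)) := by
  obtain ⟨J, hJ, hJx, hJy⟩ := exists_track_rank k
  let p : Fin (k ^ 2) → Fin n := fun e => a (trackBlock k e - 1) (J e)
  have hblock : ∀ e, (centerSystem h h3142).block (p e) = s + trackBlock k e := by
    intro e
    have h1 := hJ e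
    have h2 := ha.block (trackBlock k e - 1) (by omega) (J e) h1.1
    change (centerSystem h h3142).block (a (trackBlock k e - 1) (J e)) = _
    omega
  have harm : ∀ e, centerArm π L M (p e) % 4 = (s + trackBlock k e) % 4 := by
    intro e
    rw [← hblock e]
    exact (centerSystem h h3142).arm_mod (p e)
  have hkey : ∀ e e' c c', c % 4 = c' % 4 → (s + trackBlock k e = c ∨ s + trackBlock k e = c + 1) →
      (s + trackBlock k e' = c' ∨ s + trackBlock k e' = c' + 1) →
      (c < c' ∨ (c = c' ∧ (J e < J e' ∨ (J e = J e' ∧ trackBlock k e < trackBlock k e')))) →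
      centerKey π L M c (p e) < centerKey π L M c (p e') := by
    intro e e' c c' hcc hc hc' hlt
    have h1 := hJ e
    have h1' := hJ e'
    rw [← hblock] at hc hc'
    rcases hlt with hlt | ⟨rfl, hlt⟩
    · exact (centerSystem h h3142).key_lt_of_block_lt hlt hcc hc hc'
    · refine (hτ c _ _ hc hc').2 ?_
      rw [hblock] at hc hc'
      rcases Nat.eq_zero_or_pos c with hc0 | hc0
      · exact ha.lt (c := 0) (by omega) (by omega) h1.1 h1'.1 (by omega) (by omega) (by omega)
      -- Grid index `i` is block `s + 1 + i`, so `c` corresponds to index `c - s - 1`; for `c = s`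
      -- only index `0` occurs.
      · exact ha.lt (c := if s < c then c - s - 1 else 0) (by omega) (by omega) h1.1 h1'.1
          (by split_ifs <;> omega) (by split_ifs <;> omega) (by omega)
  -- Blocks `2p - 1` and `2p` share columns, whose depth is the key of index `s + 2p - 1`; on the
  -- same side of the center, larger `p` is deeper.
  have hodd : ∀ e e', (trackBlock k e + 1) / 2 % 2 = (trackBlock k e' + 1) / 2 % 2 →
      ((trackBlock k e + 1) / 2 < (trackBlock k e' + 1) / 2 ∨
        ((trackBlock k e + 1) / 2 = (trackBlock k e' + 1) / 2 ∧ (e : ℕ) < e')) →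
      centerKey π L M (s + 2 * ((trackBlock k e + 1) / 2) - 1) (p e) <
        centerKey π L M (s + 2 * ((trackBlock k e + 1) / 2) - 1) (p e') := by
    intro e e' hpar hlt
    have h1 := hJ e
    have h1' := hJ e'
    have h2 := hJx e e'
    exact hkey e e' _ (s + 2 * ((trackBlock k e' + 1) / 2) - 1) (by omega) (by omega) (by omega)
      (by rcases hlt with hlt | hlt <;> [left; right] <;> omega)
  have heven : ∀ e e', trackBlock k e / 2 % 2 = trackBlock k e' / 2 % 2 →
      (trackBlock k e / 2 < trackBlock k e' / 2 ∨
        (trackBlock k e / 2 = trackBlock k e' / 2 ∧ (kTrack k e : ℕ) < kTrack k e')) →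
      centerKey π L M (s + 2 * (trackBlock k e / 2)) (p e) <
        centerKey π L M (s + 2 * (trackBlock k e / 2)) (p e') := by
    intro e e' hpar hlt
    have h1 := hJ e
    have h1' := hJ e'
    have h2 := hJy e e'
    exact hkey e e' _ (s + 2 * (trackBlock k e' / 2)) (by omega) (by omega) (by omega)
      (by rcases hlt with hlt | hlt <;> [left; right] <;> omega)
  rw [Nat.even_iff] at hs
  -- The first block lies above left, as in the twirl, or in the opposite arm below right, which
  -- turns everything by 180 degrees.
  obtain hs | hs : s % 4 = 0 ∨ s % 4 = 2 := by omega
  · left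
    refine contains_ofPoints (twirlX_injective _) (twirlY_injective _ _) p ?_ ?_
    · intro e e' hlt
      have h1 := hJ e
      have h1' := hJ e'
      have ae := harm e
      have ae' := harm e'
      rw [twirlX_lt_iff] at hlt
      simp only [Nat.odd_iff] at hlt
      rcases hlt with ⟨h2, h3⟩ | ⟨h2, h3, h4⟩ | ⟨h2, h3, h4⟩
      · exact pos_lt_of_arm (L := L) (M := M) (by omega) (by omega)
      · exact pos_lt_of_key_lt_left (by omega) (by omega) (by omega) (hodd e e' (by omega) h4)
      · exact pos_lt_of_key_lt_right (by omega) (by omega) (by omega)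
          (hodd e' e (by omega) (by omega))
    · intro e e' hlt
      have h1 := hJ e
      have h1' := hJ e'
      have ae := harm e
      have ae' := harm e'
      rw [twirlY_lt_iff] at hlt
      simp only [Nat.odd_iff] at hlt
      rcases hlt with ⟨h2, h3⟩ | ⟨h2, h3, h4⟩ | ⟨h2, h3, h4⟩
      · exact val_lt_of_arm (π := π) (L := L) (M := M) (by omega) (by omega)
      · exact val_lt_of_key_lt_below (by omega) (by omega) (by omega) (heven e e' (by omega) h4)
      · exact val_lt_of_key_lt_above (by omega) (by omega) (by omega)
          (heven e' e (by omega) (by omega))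
  · right
    refine contains_revComp_ofPoints (twirlX_injective _) (twirlY_injective _ _) p ?_ ?_
    · intro e e' hlt
      have h1 := hJ e
      have h1' := hJ e'
      have ae := harm e
      have ae' := harm e'
      rw [twirlX_lt_iff] at hlt
      simp only [Nat.odd_iff] at hlt
      rcases hlt with ⟨h2, h3⟩ | ⟨h2, h3, h4⟩ | ⟨h2, h3, h4⟩
      · exact pos_lt_of_arm (L := L) (M := M) (by omega) (by omega)
      · exact pos_lt_of_key_lt_right (by omega) (by omega) (by omega) (hodd e e' (by omega) h4)
      · exact pos_lt_of_key_lt_left (by omega) (by omega) (by omega)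
          (hodd e' e (by omega) (by omega))
    · intro e e' hlt
      have h1 := hJ e
      have h1' := hJ e'
      have ae := harm e
      have ae' := harm e'
      rw [twirlY_lt_iff] at hlt
      simp only [Nat.odd_iff] at hlt
      rcases hlt with ⟨h2, h3⟩ | ⟨h2, h3, h4⟩ | ⟨h2, h3, h4⟩
      · exact val_lt_of_arm (π := π) (L := L) (M := M) (by omega) (by omega)
      · exact val_lt_of_key_lt_above (by omega) (by omega) (by omega) (heven e e' (by omega) h4)
      · exact val_lt_of_key_lt_below (by omega) (by omega) (by omega)
          (heven e' e (by omega) (by omega))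

theorem contains_of_size_zero {n k : ℕ} (hk : k = 0) (π : Equiv.Perm (Fin n))
    (σ : Equiv.Perm (Fin k)) : Contains π σ := by
  subst hk
  exact ⟨Fin.elim0, fun i => i.elim0, fun i => i.elim0⟩

end PermPattern

theorem mainTheorem8 (n k r : ℕ) (π : Equiv.Perm (Fin n))
    (hπ : π ∈ PermPattern.Av
      {⟨4, PermPattern.p2143⟩, ⟨4, PermPattern.p3412⟩, ⟨4, PermPattern.p3142⟩} n)
    (hr_even : Even r) (hr_two : 2 ≤ r)
    (hr : 300 * (k : ℝ) ^ (3 / 2 : ℝ) ≤ (r : ℝ))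
    (hwall : PermPattern.ContainsWall (PermPattern.permGraph π) r) :
    PermPattern.Contains π (PermPattern.kSpiral k) ∨
      PermPattern.Contains π (PermPattern.revComp (PermPattern.kSpiral k)) := by
  open PermPattern in
  rcases Nat.eq_zero_or_pos k with rfl | hk
  · exact Or.inl (contains_of_size_zero rfl _ _)
  -- For `k ≥ 1` the bound implies a linear one, and the mesh with `r - 1` rows then has at least
  -- `299 * k` of them.
  have hrk : 300 * k ≤ r := by
    have h1 : (1 : ℝ) ≤ k := by exact_mod_cast hk
    have h2 : (k : ℝ) ≤ (k : ℝ) ^ (3 / 2 : ℝ) := by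
      simpa using Real.rpow_le_rpow_of_exponent_le h1 (show (1 : ℝ) ≤ 3 / 2 by norm_num)
    have h3 : (300 : ℝ) * k ≤ r := by linarith
    exact_mod_cast h3
  have h2143 : ¬ Contains π p2143 := hπ ⟨4, p2143⟩ (by simp)
  have h3412 : ¬ Contains π p3412 := hπ ⟨4, p3412⟩ (by simp)
  have h3142 : ¬ Contains π p3142 := hπ ⟨4, p3142⟩ (by simp)
  obtain ⟨L, M, hc⟩ := exists_isCenter h2143 h3412
  obtain ⟨τ, hinj, hτ⟩ := (centerSystem hc h3142).exists_time
  obtain ⟨R, C, hm⟩ := exists_isMesh_of_containsWall hr_two hwall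
  obtain ⟨s, hs, hw⟩ := (isStripGraph_permGraph hc h3142 hinj hτ).exists_wave_nonempty hm hk
    (by omega)
  obtain ⟨a, ha⟩ := exists_isTrackGrid (s := s + 1) hk fun i h1 h2 => hw i (by omega) (by omega)
  exact contains_kSpiral_of_isTrackGrid hc h3142 hτ hs ha
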